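/- Let $T$ be a complete first-order theory and $G$ a $\emptyset$-definable group. Let $\mathcal E=\{\varphi_i(x,y,\bar z_i): i\in I\}$ be a family of formulas, indexed by a nonempty directed set $I$, such that each $\varphi_i$ implies $x,y\in G$ and, for $i<j$, $(\forall \bar z_i)(\exists \bar z_j)(\forall x,y)(\varphi_j(x,y,\bar z_j)\to\varphi_i(x,y,\bar z_i))$. For a model $M$ of $T$ put $E_M:=\bigcap\{\varphi_i(x,y,\bar b): i\in I,\ \bar b\subseteq M\}$, and assume that for every model $M$ the $M$-type-definable relation $E_M$ is an equivalence relation on $G$. A monster model $M^*$ is a $\kappa$-saturated, strongly $\kappa$-homogeneous model of $T$ with $\kappa>|T|$, where $|T|$ is the maximum of $\aleph_0$ and the size of the language. Models $M\prec M^*$ are small ($|M|<\kappa$), and $G=G(M^*)$. "Definable" means definable with parameters from $M^*$, and "type-definable" means an intersection of sets definable over a common parameter set of size $<\kappa$. For $R\subseteq G\times G$, $Y\subseteq G$ and $g\in G$ put $gR=\{(gx,gy):(x,y)\in R\}$ and $R\circ Y=\{x:\exists y\in Y\ R(y,x)\}$. A *$G$-pre-mean for $\mathcal E_M$* is a monotone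 function $m$ from the definable subsets of $G$ to $[0,1]$ with $m(\emptyset)=0$, $m(G)=1$ and $m(Y\cup Y')\le m(Y)+m(Y')$, where equality holds whenever $\big((g_1\varphi_i(x,y,\bar b_1)\cap\dots\cap g_n\varphi_i(x,y,\bar b_n))\circ Y\big)\cap Y'=\emptyset$ for some $g_1,\dots,g_n\in G$, $i\in I$ and $\bar b_1,\dots,\bar b_n$ from $M$. Let $\mathcal D_{\mathcal E_M}$ be the lattice of type-definable $Y\subseteq G$ with $(g_1E_M\cap\dots\cap g_nE_M)\circ Y=Y$ for some $g_1,\dots,g_n\in G$. A *normalized mean* on it is a monotone $\rho:\mathcal D_{\mathcal E_M}\to[0,1]$ with $\rho(\emptyset)=0$, $\rho(G)=1$ and $\rho(Y\cup Z)=\rho(Y)+\rho(Z)-\rho(Y\cap Z)$. Invariance of $m$ or $\rho$ is under left translations. If $E_M$ is $G(M)$-invariant (that is, $gE_M=E_M$ for all $g\in G(M)$), then $G(M)$ acts by left translation on the space $S_{G/E_M}(M)$ of complete types over $M$ of elements of $G/E_M$, which carries the quotient topology from $S_G(M)$. (a) Let $M\prec M^*$ be as above and assume that $E_M$ is $G(M)$-invariant.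 The following are equivalent: 1. $S_{G/E_M}(M)$ carries a $G(M)$-invariant Borel probability measure; 2. there is a $G(M)$-invariant $G$-pre-mean for $\mathcal E_M$; 3. there is a $G$-invariant $G$-pre-mean for $\mathcal E_M$; 4. $\mathcal D_{\mathcal E_M}$ carries a $G(M)$-invariant normalized mean; 5. $\mathcal D_{\mathcal E_M}$ carries a $G$-invariant normalized mean. (b) The existence of a $G$-invariant $G$-pre-mean for $\mathcal E_M$, and the existence of a $G$-invariant normalized mean on $\mathcal D_{\mathcal E_M}$, depend neither on $M$ nor on the monster model $M^*$ (no invariance of $E_M$ is assumed here). The existence of a $G(M)$-invariant Borel probability measure on $S_{G/E_M}(M)$ takes the same value for any two models $M$ (in any two monster models) for which $E_M$ is $G(M)$-invariant. -/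

import Mathlib

open FirstOrder FirstOrder.Language Cardinal Set MeasureTheory
open scoped Pointwise

universe u v w z

noncomputable section

namespace VeeAmenability

/-! ### Monster models -/

section Monster

variable (L : FirstOrder.Language.{u, v}) (κ : Cardinal.{w}) (N : Type w) [L.Structure N]

/-- `N` is `κ`-saturated: every set of formulas in finitely many variables, with parameters from
a set of cardinality `< κ`, which is finitely satisfiable in `N` is realized in `N`. -/
def IsSaturated : Prop :=
  ∀ (A : Set N), #A < κ → ∀ (n : ℕ) (p : Set (L[[A]].Formula (Fin n))),
    (∀ p₀ : Finset (L[[A]].Formula (Fin n)), (p₀ : Set (L[[A]].Formula (Fin n))) ⊆ p →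
      ∃ a : Fin n → N, ∀ φ ∈ p₀, φ.Realize a) →
    ∃ a : Fin n → N, ∀ φ ∈ p, φ.Realize a

/-- `N` is strongly `κ`-homogeneous: every partial elementary map between subsets of `N` of
cardinality `< κ` extends to an automorphism of `N`. -/
def IsStronglyHomogeneous : Prop :=
  ∀ (A : Set N), #A < κ → ∀ f : A → N,
    (∀ φ : L.Formula A, φ.Realize (fun a : A => (a : N)) ↔ φ.Realize f) →
    ∃ σ : N ≃[L] N, ∀ a : A, σ a = f a

/-- `N` is a monster model with respect to `κ`: it is `κ`-saturated and strongly
`κ`-homogeneous, and `κ` exceeds `|L| + ℵ₀`. A set is small when its cardinality is `< κ`. -/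
structure IsMonster : Prop where
  aleph0_lt : ℵ₀ < κ
  card_lt : Cardinal.lift.{w} L.card < Cardinal.lift.{max u v} κ
  saturated : IsSaturated L κ N
  homogeneous : IsStronglyHomogeneous L κ N

end Monster

variable {L : FirstOrder.Language.{u, v}} {T : L.Theory}

/-! ### Definable groups -/

/-- A `∅`-definable group in the models of `T`: a formula for the universe and a formula for the
graph of the multiplication, which define a group in every model of `T`. -/
structure DefinableGroup (T : L.Theory) where
  dim : ℕ
  dom : L.Formula (Fin dim)
  mulGraph : L.Formula (Fin dim ⊕ Fin dim ⊕ Fin dim)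
  exists_unique_mul : ∀ (N : Type w) [L.Structure N] [N ⊨ T] [Nonempty N] (x y : Fin dim → N),
    dom.Realize x → dom.Realize y →
    ∃! t : Fin dim → N, dom.Realize t ∧ mulGraph.Realize (Sum.elim x (Sum.elim y t))
  assoc : ∀ (N : Type w) [L.Structure N] [N ⊨ T] [Nonempty N] (x y t xy yt r : Fin dim → N),
    dom.Realize x → dom.Realize y → dom.Realize t → dom.Realize xy → dom.Realize yt →
    dom.Realize r →
    mulGraph.Realize (Sum.elim x (Sum.elim y xy)) →
    mulGraph.Realize (Sum.elim y (Sum.elim t yt)) →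
    mulGraph.Realize (Sum.elim xy (Sum.elim t r)) →
    mulGraph.Realize (Sum.elim x (Sum.elim yt r))
  exists_one_inv : ∀ (N : Type w) [L.Structure N] [N ⊨ T] [Nonempty N],
    ∃ e : Fin dim → N, dom.Realize e ∧ ∀ x, dom.Realize x →
      mulGraph.Realize (Sum.elim e (Sum.elim x x)) ∧
      ∃ y, dom.Realize y ∧ mulGraph.Realize (Sum.elim y (Sum.elim x e))

namespace DefinableGroup

variable (G : DefinableGroup.{u, v, w} T) (N : Type w) [L.Structure N]

/-- The interpretation `G(N)` of the definable group in `N`. -/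
def Points : Type w := {x : Fin G.dim → N // G.dom.Realize x}

section Group

variable [N ⊨ T] [Nonempty N]

variable {G N} in
lemma exists_mul (x y : G.Points N) :
    ∃ t : G.Points N, G.mulGraph.Realize (Sum.elim x.1 (Sum.elim y.1 t.1)) := by
  obtain ⟨t, ⟨h, h1⟩, -⟩ := G.exists_unique_mul N x.1 y.1 x.2 y.2
  exact ⟨⟨t, h⟩, h1⟩

instance : Mul (G.Points N) := ⟨fun x y => (exists_mul x y).choose⟩

variable {G N} in
lemma realize_mul (x y : G.Points N) :
    G.mulGraph.Realize (Sum.elim x.1 (Sum.elim y.1 (x * y).1)) :=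
  (exists_mul x y).choose_spec

variable {G N} in
lemma mul_eq {x y t : G.Points N}
    (h : G.mulGraph.Realize (Sum.elim x.1 (Sum.elim y.1 t.1))) : x * y = t :=
  Subtype.ext ((G.exists_unique_mul N x.1 y.1 x.2 y.2).unique ⟨(x * y).2, realize_mul x y⟩
    ⟨t.2, h⟩)

lemma exists_one : ∃ e : G.Points N, ∀ x : G.Points N, e * x = x ∧ ∃ y, y * x = e := by
  obtain ⟨e, he, h⟩ := G.exists_one_inv N
  refine ⟨⟨e, he⟩, fun x => ?_⟩
  obtain ⟨h1, y, hy, h2⟩ := h x.1 x.2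
  exact ⟨mul_eq h1, ⟨y, hy⟩, mul_eq h2⟩

/-- `G(N)` is a group whose multiplication has the prescribed graph. -/
instance : Group (G.Points N) :=
  letI : One (G.Points N) := ⟨(G.exists_one N).choose⟩
  letI : Inv (G.Points N) := ⟨fun x => ((G.exists_one N).choose_spec x).2.choose⟩
  Group.ofLeftAxioms
    (fun x y t => (mul_eq (G.assoc N x.1 y.1 t.1 (x * y).1 (y * t).1 (x * y * t).1 x.2 y.2 t.2
      (x * y).2 (y * t).2 (x * y * t).2 (realize_mul x y) (realize_mul y t)
      (realize_mul (x * y) t))).symm)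
    (fun x => ((G.exists_one N).choose_spec x).1)
    (fun x => ((G.exists_one N).choose_spec x).2.choose_spec)

end Group

variable {G N}

/-- For an elementary substructure `M` of `N`, the elements of `G(N)` with coordinates in `M`;
this is the copy of `G(M)` inside `G(N)`. -/
def pointsIn (M : Set N) : Set (G.Points N) := {g | ∀ k, g.1 k ∈ M}

/-- A subset of `G(N)` is definable over the parameter set `A`. -/
def IsDefinableOver (A : Set N) (Y : Set (G.Points N)) : Prop :=
  A.Definable L ((Subtype.val : G.Points N → Fin G.dim → N) '' Y)

/-- A subset of `G(N)` is definable, with arbitrary parameters. -/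
def IsDefinable (Y : Set (G.Points N)) : Prop := IsDefinableOver univ Y

/-- A subset of `G(N)` is type-definable: an intersection of sets definable over some parameter
set of cardinality `< κ`. -/
def IsTypeDefinable (κ : Cardinal.{w}) (Y : Set (G.Points N)) : Prop :=
  ∃ A : Set N, #A < κ ∧ ∃ S : Set (Set (G.Points N)), (∀ D ∈ S, IsDefinableOver A D) ∧ Y = ⋂₀ S

/-- The action of an automorphism of `N` on `G(N)`. -/
def autMap (σ : N ≃[L] N) (x : G.Points N) : G.Points N :=
  ⟨σ ∘ x.1, (StrongHomClass.realize_formula σ G.dom).2 x.2⟩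

lemma autMap_mul [N ⊨ T] [Nonempty N] (σ : N ≃[L] N) (x y : G.Points N) :
    autMap σ (x * y) = autMap σ x * autMap σ y := by
  refine (mul_eq ?_).symm
  have h := (StrongHomClass.realize_formula σ G.mulGraph).2 (realize_mul x y)
  simpa only [Sum.comp_elim, autMap] using h

lemma autMap_of_mem {M : Set N} {σ : N ≃[L] N} (hσ : ∀ a ∈ M, σ a = a) {g : G.Points N}
    (hg : g ∈ pointsIn M) : autMap σ g = g :=
  Subtype.ext (funext fun k => hσ _ (hg k))

lemma autMap_autMap (σ τ : N ≃[L] N) (x : G.Points N) :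
    autMap σ (autMap τ x) = autMap (σ.comp τ) x := rfl

lemma autMap_symm (σ : N ≃[L] N) (x : G.Points N) : autMap σ.symm (autMap σ x) = x :=
  Subtype.ext (funext fun k => σ.symm_apply_apply (x.1 k))

end DefinableGroup

open DefinableGroup

/-! ### Equivalence relations defined by families of formulas -/

/-- A family of formulas `φ i (x, y, z)`, with `i` in a preorder `I` and `z` a finite tuple of
parameter variables depending on `i`, such that each `φ i` implies `x, y ∈ G` and, for `i ≤ j`,
every instance of `φ i` contains an instance of `φ j`. -/
structure VeeFamily (G : DefinableGroup.{u, v, w} T) (I : Type z) [Preorder I] where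
  arity : I → ℕ
  form : ∀ i, L.Formula (Fin G.dim ⊕ Fin G.dim ⊕ Fin (arity i))
  dom_of_form : ∀ (N : Type w) [L.Structure N] [N ⊨ T] [Nonempty N] (i : I)
    (x y : Fin G.dim → N) (b : Fin (arity i) → N),
    (form i).Realize (Sum.elim x (Sum.elim y b)) → G.dom.Realize x ∧ G.dom.Realize y
  refine_of_le : ∀ (N : Type w) [L.Structure N] [N ⊨ T] [Nonempty N] (i j : I), i ≤ j →
    ∀ b : Fin (arity i) → N, ∃ c : Fin (arity j) → N, ∀ x y : Fin G.dim → N,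
      (form j).Realize (Sum.elim x (Sum.elim y c)) → (form i).Realize (Sum.elim x (Sum.elim y b))

namespace VeeFamily

variable {G : DefinableGroup.{u, v, w} T} {I : Type z} [Preorder I] (E : VeeFamily G I)
variable {N : Type w} [L.Structure N]

/-- The relation on `G(N)` defined by the instance `φ i (x, y, b)`. -/
def inst (i : I) (b : Fin (E.arity i) → N) : SetRel (G.Points N) (G.Points N) :=
  {p | (E.form i).Realize (Sum.elim p.1.1 (Sum.elim p.2.1 b))}

/-- The relation `E_M` on `G(N)`: the intersection of all instances with parameters in `M`. -/
def rel (M : Set N) : SetRel (G.Points N) (G.Points N) :=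
  {p | ∀ (i : I) (b : Fin (E.arity i) → N), (∀ l, b l ∈ M) → p ∈ E.inst i b}

/-- The family defines an equivalence relation: for every model `M` of `T`, the partial type
`E_M` over `M` defines an equivalence relation on `G` (in elementary extensions `N` of `M`). -/
def DefinesEquivalence : Prop :=
  ∀ (N : Type w) [L.Structure N] [N ⊨ T] [Nonempty N] (M : L.ElementarySubstructure N),
    _root_.Equivalence fun x y : G.Points N => (x, y) ∈ E.rel (M : Set N)

section

variable [N ⊨ T] [Nonempty N]

/-- `E_M` is invariant under left translation by elements of `G(M)`. -/
def IsInvariant (M : Set N) : Prop :=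
  ∀ g ∈ pointsIn (G := G) M, ∀ x y : G.Points N,
    (x, y) ∈ E.rel M → (g * x, g * y) ∈ E.rel M

/-- A `G`-pre-mean for the family over `M`: only the values on definable subsets of `G(N)`
matter. Here `g • R = {(g x, g y) | (x, y) ∈ R}` and
`R.image Y = {x | ∃ y ∈ Y, (y, x) ∈ R}`. -/
structure IsGPreMean (M : Set N) (m : Set (G.Points N) → ℝ) : Prop where
  mem_Icc : ∀ Y, IsDefinable Y → m Y ∈ Set.Icc (0 : ℝ) 1
  empty : m ∅ = 0
  univ : m Set.univ = 1
  monotone : ∀ Y Z, IsDefinable Y → IsDefinable Z → Y ⊆ Z → m Y ≤ m Z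
  union_le : ∀ Y Z, IsDefinable Y → IsDefinable Z → m (Y ∪ Z) ≤ m Y + m Z
  union_eq : ∀ Y Z, IsDefinable Y → IsDefinable Z →
    ∀ (i : I) (n : ℕ) (g : Fin n → G.Points N) (b : Fin n → Fin (E.arity i) → N),
      (∀ k l, b k l ∈ M) →
      SetRel.image (⋂ k, g k • E.inst i (b k)) Y ∩ Z = ∅ → m (Y ∪ Z) = m Y + m Z

/-- The lattice of type-definable subsets `Y` of `G(N)` such that
`(g₁ E_M ∩ ⋯ ∩ gₙ E_M) ∘ Y = Y` for some `g₁, …, gₙ ∈ G(N)`. -/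
def lattice (κ : Cardinal.{w}) (M : Set N) : Set (Set (G.Points N)) :=
  {Y | IsTypeDefinable κ Y ∧ ∃ (n : ℕ) (g : Fin n → G.Points N),
    SetRel.image (⋂ k, g k • E.rel M) Y = Y}

end

/-- Two elements of `G(N)` are related when their classes modulo `E_M` have the same type over
`M`, i.e. when some automorphism of `N` over `M` takes one class to the other. -/
def SameType (M : Set N) (x y : G.Points N) : Prop :=
  ∃ σ : N ≃[L] N, (∀ a ∈ M, σ a = a) ∧ (autMap σ x, y) ∈ E.rel M

variable {E}

lemma rel_autMap {M : Set N} {σ : N ≃[L] N} (hσ : ∀ a ∈ M, σ a = a) {x y : G.Points N}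
    (h : (x, y) ∈ E.rel M) : (autMap σ x, autMap σ y) ∈ E.rel M := by
  intro i b hb
  have h1 := (StrongHomClass.realize_formula σ (E.form i)).2 (h i b hb)
  have h2 : σ ∘ b = b := funext fun l => hσ _ (hb l)
  simp only [Sum.comp_elim, h2] at h1
  exact h1

lemma symm_fix {M : Set N} {σ : N ≃[L] N} (hσ : ∀ a ∈ M, σ a = a) (a : N) (ha : a ∈ M) :
    σ.symm a = a := by
  conv_lhs => rw [← hσ a ha]
  exact σ.symm_apply_apply a

variable [N ⊨ T] [Nonempty N]

variable (E) in
/-- Equality of types over `M` of classes modulo `E_M`. -/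
def typeSetoid (hE : E.DefinesEquivalence) (M : L.ElementarySubstructure N) :
    Setoid (G.Points N) where
  r := E.SameType (M : Set N)
  iseqv :=
    { refl := fun x => ⟨Language.Equiv.refl L N, fun _ _ => rfl, (hE N M).refl x⟩
      symm := by
        rintro x y ⟨σ, hσ, h⟩
        refine ⟨σ.symm, symm_fix hσ, ?_⟩
        have h1 := rel_autMap (symm_fix hσ) ((hE N M).symm h)
        rwa [autMap_symm] at h1
      trans := by
        rintro x y t ⟨σ, hσ, h⟩ ⟨τ, hτ, h'⟩
        refine ⟨τ.comp σ, fun a ha => ?_, ?_⟩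
        · rw [Language.Equiv.comp_apply, hσ a ha, hτ a ha]
        · rw [← autMap_autMap]
          exact (hE N M).trans (rel_autMap hτ h) h' }

variable (E) in
/-- The space `S_{G/E_M}(M)` of complete types over `M` of elements of `G/E_M`, with `N` a monster
model in which `M` is small. -/
def TypeSpace (hE : E.DefinesEquivalence) (M : L.ElementarySubstructure N) : Type w :=
  Quotient (E.typeSetoid hE M)

section TypeSpace

variable {hE : E.DefinesEquivalence} {M : L.ElementarySubstructure N}

/-- The quotient topology; the topology on `G(N)` generated by the `M`-definable subsets is the
one induced from the type space `S_G(M)`. A set is closed if and only if its preimage in `G(N)`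
is an intersection of `M`-definable sets. -/
instance : TopologicalSpace (E.TypeSpace hE M) :=
  TopologicalSpace.coinduced (Quotient.mk (E.typeSetoid hE M))
    (TopologicalSpace.generateFrom {D : Set (G.Points N) | IsDefinableOver (M : Set N) D})

instance : MeasurableSpace (E.TypeSpace hE M) := borel _

instance : BorelSpace (E.TypeSpace hE M) := ⟨rfl⟩

variable (hE M) in
/-- The action of `g ∈ G(M)` on `S_{G/E_M}(M)`, which takes the type of the class of `x` to the
type of the class of `g x`. -/
def translate (hinv : E.IsInvariant (M : Set N)) (g : G.Points N)
    (hg : g ∈ pointsIn (M : Set N)) : E.TypeSpace hE M → E.TypeSpace hE M :=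
  Quotient.map (fun x => g * x) (by
    rintro x y ⟨σ, hσ, h⟩
    refine ⟨σ, hσ, ?_⟩
    rw [autMap_mul, autMap_of_mem hσ hg]
    exact hinv g hg _ _ h)

variable (hE M) in
/-- `S_{G/E_M}(M)` carries a `G(M)`-invariant Borel probability measure. -/
def HasInvariantMeasure (hinv : E.IsInvariant (M : Set N)) : Prop :=
  ∃ μ : Measure (E.TypeSpace hE M), IsProbabilityMeasure μ ∧
    ∀ (g : G.Points N) (hg : g ∈ pointsIn (M : Set N)),
      MeasurePreserving (translate hE M hinv g hg) μ μ

end TypeSpace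

variable (E)

/-- There is a `G`-pre-mean over `M` which is invariant under translation by the elements
of `H`. -/
def HasInvariantGPreMean (M : Set N) (H : Set (G.Points N)) : Prop :=
  ∃ m : Set (G.Points N) → ℝ, E.IsGPreMean M m ∧
    ∀ g ∈ H, ∀ Y, IsDefinable Y → m (g • Y) = m Y

end VeeFamily

/-- A normalized mean on a lattice `D` of subsets of `X` with `∅, X ∈ D`: only the values on `D`
matter. -/
structure IsNormalizedMean {X : Type w} (D : Set (Set X)) (ρ : Set X → ℝ) : Prop where
  mem_Icc : ∀ Y ∈ D, ρ Y ∈ Set.Icc (0 : ℝ) 1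
  empty : ρ ∅ = 0
  univ : ρ Set.univ = 1
  monotone : ∀ Y ∈ D, ∀ Z ∈ D, Y ⊆ Z → ρ Y ≤ ρ Z
  modular : ∀ Y ∈ D, ∀ Z ∈ D, ρ (Y ∪ Z) = ρ Y + ρ Z - ρ (Y ∩ Z)

/-- The family `D` of subsets of the group `X` carries a normalized mean which is invariant under
translation by the elements of `H`. -/
def HasInvariantMean {X : Type w} [Group X] (D : Set (Set X)) (H : Set X) : Prop :=
  ∃ ρ : Set X → ℝ, IsNormalizedMean D ρ ∧ ∀ g ∈ H, ∀ Y ∈ D, ρ (g • Y) = ρ Y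

end VeeAmenability

end

/-! Pre-means are what travels between models, because their axioms are first-order conditions on
formulas and parameters; measures and means are then compared with pre-means inside one monster
model.

Transfer: as `T` is complete, every formula realized in a model `N₂` is realized in every other
model `M`, so some ultrafilter on the maps `f : N₂ → M` makes `f` elementary in the limit. Given a
function `m₁` on `M`-definable sets with the properties of a pre-mean, the ultralimit of the values
of `m₁` on the set defined by `φ` with parameters `f` is a pre-mean on `N₂`. Since `f` moves every
parameter and every group element into `M`, invariance under `G(M)` becomes invariance under
`G(N₂)`, and instances with any parameters in `N₂` may be used (`IsLocalPreMean.exists_isGPreMean`).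
This yields 2 → 3 and independence of the model.

Measure to pre-mean: give an `M`-definable set the measure of its image in the type space. If two
such sets are separated by `G(M)`-translates of instances, their images are disjoint, because each
translate contains `E_M` by invariance. Transfer completes 1 → 3.

Pre-mean to mean and back: infima over definable supersets turn a pre-mean into a mean, with
compactness replacing type-definable separation by separation through finitely many instances
(`IsGPreMean.isNormalizedMean_outer`). Conversely, the infimum of a mean over all saturations of a
definable set is a pre-mean (`HasInvariantMean.hasInvariantGPreMean`).

Mean to measure: the type space is compact Hausdorff and its closed sets pull back into the lattice,
so a mean restricts to an invariant content, which induces a Borel measure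
(`hasInvariantMeasure_of_hasInvariantMean`). -/

namespace VeeAmenability

noncomputable section

/-! ### Uniformly first-order predicates -/

section FirstOrderPredicates

variable {L : FirstOrder.Language.{u, v}}

/-- A predicate on tuples, given in every structure, which is defined by one formula. -/
def IsFirstOrder {α : Type*} (P : ∀ (N : Type w) [L.Structure N], (α → N) → Prop) : Prop :=
  ∃ φ : L.Formula α, ∀ (N : Type w) [L.Structure N] (v : α → N), φ.Realize v ↔ P N v

namespace IsFirstOrder

variable {α β γ : Type*} {P Q : ∀ (N : Type w) [L.Structure N], (α → N) → Prop}

/-- The atomic case, where the assignment `t` is a renaming `s` of the variables. Stating the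
agreement pointwise lets a case split on the sum types and `rfl` prove it. -/
lemma formula (φ : L.Formula γ) (t : ∀ N : Type w, (α → N) → γ → N) (s : γ → α)
    (h : ∀ N v c, t N v c = v (s c)) :
    IsFirstOrder (L := L) fun N _ v => φ.Realize (t N v) :=
  ⟨φ.relabel s, fun N _ v => by
    simp only [Formula.realize_relabel, show t N v = v ∘ s from funext (h N v)]⟩

lemma not (hP : IsFirstOrder P) : IsFirstOrder (L := L) fun N _ v => ¬ P N v := by
  obtain ⟨φ, hφ⟩ := hP
  exact ⟨φ.not, fun N _ v => by rw [Formula.realize_not, hφ]⟩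

lemma and (hP : IsFirstOrder P) (hQ : IsFirstOrder Q) :
    IsFirstOrder (L := L) fun N _ v => P N v ∧ Q N v := by
  obtain ⟨φ, hφ⟩ := hP
  obtain ⟨ψ, hψ⟩ := hQ
  exact ⟨φ ⊓ ψ, fun N _ v => by rw [Formula.realize_inf, hφ, hψ]⟩

lemma imp (hP : IsFirstOrder P) (hQ : IsFirstOrder Q) :
    IsFirstOrder (L := L) fun N _ v => P N v → Q N v := by
  obtain ⟨φ, hφ⟩ := hP
  obtain ⟨ψ, hψ⟩ := hQ
  exact ⟨φ.imp ψ, fun N _ v => by rw [Formula.realize_imp, hφ, hψ]⟩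

lemma iff (hP : IsFirstOrder P) (hQ : IsFirstOrder Q) :
    IsFirstOrder (L := L) fun N _ v => (P N v ↔ Q N v) := by
  obtain ⟨φ, hφ⟩ := hP
  obtain ⟨ψ, hψ⟩ := hQ
  exact ⟨φ.iff ψ, fun N _ v => by rw [Formula.realize_iff, hφ, hψ]⟩

lemma iAnd [Finite γ] {P : γ → ∀ (N : Type w) [L.Structure N], (α → N) → Prop}
    (hP : ∀ c, IsFirstOrder (P c)) : IsFirstOrder (L := L) fun N _ v => ∀ c, P c N v := by
  choose φ hφ using hP
  exact ⟨Formula.iInf φ, fun N _ v => by simp only [Formula.realize_iInf, hφ]⟩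

lemma forall_tuple [Finite β] {P : ∀ (N : Type w) [L.Structure N], (α → N) → (β → N) → Prop}
    (hP : IsFirstOrder (L := L) fun N _ (v : α ⊕ β → N) => P N (v ∘ Sum.inl) (v ∘ Sum.inr)) :
    IsFirstOrder (L := L) fun N _ v => ∀ x : β → N, P N v x := by
  obtain ⟨φ, hφ⟩ := hP
  exact ⟨φ.iAlls β, fun N _ v => by
    rw [Formula.realize_iAlls]; exact forall_congr' fun x => hφ N (Sum.elim v x)⟩

lemma exists_tuple [Finite β] {P : ∀ (N : Type w) [L.Structure N], (α → N) → (β → N) → Prop}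
    (hP : IsFirstOrder (L := L) fun N _ (v : α ⊕ β → N) => P N (v ∘ Sum.inl) (v ∘ Sum.inr)) :
    IsFirstOrder (L := L) fun N _ v => ∃ x : β → N, P N v x := by
  obtain ⟨φ, hφ⟩ := hP
  exact ⟨φ.iExs β, fun N _ v => by
    rw [Formula.realize_iExs]; exact exists_congr fun x => hφ N (Sum.elim v x)⟩

lemma elementarySubstructure (hP : IsFirstOrder P) {N : Type w} [L.Structure N]
    (M : L.ElementarySubstructure N) (v : α → M) : P M v ↔ P N fun a => v a := by
  obtain ⟨φ, hφ⟩ := hP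
  rw [← hφ, ← hφ]
  exact (M.subtype.map_formula φ v).symm

end IsFirstOrder

end FirstOrderPredicates

namespace DefinableGroup

variable {L : FirstOrder.Language.{u, v}} {T : L.Theory} {G : DefinableGroup.{u, v, w} T}
variable {N : Type w} [L.Structure N]

/-! ### Definable sets and definable relations -/

lemma isDefinableOver_iff {A : Set N} {Y : Set (G.Points N)} :
    IsDefinableOver A Y ↔ ∃ φ : L.Formula (A ⊕ Fin G.dim),
      ∀ x : G.Points N, x ∈ Y ↔ φ.Realize (Sum.elim (fun a : A => (a : N)) x.1) := by
  rw [IsDefinableOver, definable_iff_exists_formula_sum]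
  constructor
  · rintro ⟨φ, hφ⟩
    refine ⟨φ, fun x => ?_⟩
    have h := congrArg (x.1 ∈ ·) hφ
    simp only [eq_iff_iff] at h
    refine Iff.trans ?_ h
    exact ⟨fun hx => ⟨x, hx, rfl⟩, by rintro ⟨y, hy, h⟩; rwa [← Subtype.ext h]⟩
  · rintro ⟨φ, hφ⟩
    -- Definability refers to tuples of `N`, and outside `G(N)` the formula `φ` is unconstrained.
    refine ⟨φ ⊓ G.dom.relabel Sum.inr, ?_⟩
    ext x
    rw [mem_ofPred_eq, Formula.realize_inf, Formula.realize_relabel, Sum.elim_comp_inr]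
    constructor
    · rintro ⟨y, hy, rfl⟩
      exact ⟨(hφ y).1 hy, y.2⟩
    · rintro ⟨h1, h2⟩
      exact ⟨⟨x, h2⟩, (hφ _).2 h1, rfl⟩

/-- A relation on `G(N)` is definable over the parameter set `A`. -/
def IsDefinableRelOver (A : Set N) (R : SetRel (G.Points N) (G.Points N)) : Prop :=
  ∃ φ : L.Formula (A ⊕ (Fin G.dim ⊕ Fin G.dim)), ∀ x y : G.Points N,
    (x, y) ∈ R ↔ φ.Realize (Sum.elim (fun a : A => (a : N)) (Sum.elim x.1 y.1))

lemma IsDefinableRelOver.of_isFirstOrder {A : Set N} {R : SetRel (G.Points N) (G.Points N)}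
    {P : ∀ (N : Type w) [L.Structure N], (A ⊕ (Fin G.dim ⊕ Fin G.dim) → N) → Prop}
    (hP : IsFirstOrder P) (h : ∀ x y : G.Points N,
      (x, y) ∈ R ↔ P N (Sum.elim (fun a : A => (a : N)) (Sum.elim x.1 y.1))) :
    IsDefinableRelOver A R := by
  obtain ⟨φ, hφ⟩ := hP
  exact ⟨φ, fun x y => by rw [h, hφ]⟩

namespace IsDefinableOver

variable {A B : Set N} {Y Z : Set (G.Points N)}

lemma of_isFirstOrder {P : ∀ (N : Type w) [L.Structure N], (A ⊕ Fin G.dim → N) → Prop}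
    (hP : IsFirstOrder P)
    (h : ∀ x : G.Points N, x ∈ Y ↔ P N (Sum.elim (fun a : A => (a : N)) x.1)) :
    IsDefinableOver A Y := by
  obtain ⟨φ, hφ⟩ := hP
  exact isDefinableOver_iff.2 ⟨φ, fun x => by rw [h, hφ]⟩

lemma mono (hY : IsDefinableOver A Y) (hAB : A ⊆ B) : IsDefinableOver B Y :=
  Set.Definable.mono hY hAB

lemma isDefinable (hY : IsDefinableOver A Y) : IsDefinable Y := hY.mono (subset_univ A)

lemma inter (hY : IsDefinableOver A Y) (hZ : IsDefinableOver A Z) : IsDefinableOver A (Y ∩ Z) := by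
  obtain ⟨φ, hφ⟩ := isDefinableOver_iff.1 hY
  obtain ⟨ψ, hψ⟩ := isDefinableOver_iff.1 hZ
  exact isDefinableOver_iff.2 ⟨φ ⊓ ψ, fun x => by
    rw [Formula.realize_inf, ← hφ, ← hψ, mem_inter_iff]⟩

lemma union (hY : IsDefinableOver A Y) (hZ : IsDefinableOver A Z) : IsDefinableOver A (Y ∪ Z) := by
  obtain ⟨φ, hφ⟩ := isDefinableOver_iff.1 hY
  obtain ⟨ψ, hψ⟩ := isDefinableOver_iff.1 hZ
  exact isDefinableOver_iff.2 ⟨φ ⊔ ψ, fun x => by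
    rw [Formula.realize_sup, ← hφ, ← hψ, mem_union]⟩

lemma compl (hY : IsDefinableOver A Y) : IsDefinableOver A Yᶜ := by
  obtain ⟨φ, hφ⟩ := isDefinableOver_iff.1 hY
  exact isDefinableOver_iff.2 ⟨φ.not, fun x => by
    rw [Formula.realize_not, ← hφ, mem_compl_iff]⟩

lemma empty : IsDefinableOver A (∅ : Set (G.Points N)) :=
  isDefinableOver_iff.2 ⟨⊥, fun x => by simp⟩

lemma univ : IsDefinableOver A (Set.univ : Set (G.Points N)) := by
  simpa using (empty (G := G) (A := A)).compl

lemma image {R : SetRel (G.Points N) (G.Points N)} (hR : IsDefinableRelOver A R)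
    (hY : IsDefinableOver A Y) : IsDefinableOver A (R.image Y) := by
  obtain ⟨φ, hφ⟩ := isDefinableOver_iff.1 hY
  obtain ⟨ψ, hψ⟩ := hR
  refine of_isFirstOrder (P := fun N _ v => ∃ y : Fin G.dim → N, G.dom.Realize y ∧
    φ.Realize (Sum.elim (v ∘ Sum.inl) y) ∧
    ψ.Realize (Sum.elim (v ∘ Sum.inl) (Sum.elim y (v ∘ Sum.inr)))) ?_ ?_
  · refine .exists_tuple (.and ?_ (.and ?_ ?_))
    · exact .formula _ _ Sum.inr fun _ _ _ => rfl
    · exact .formula _ _ (Sum.elim (Sum.inl ∘ Sum.inl) Sum.inr) (by rintro _ _ (_ | _) <;> rfl)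
    · exact .formula _ _ (Sum.elim (Sum.inl ∘ Sum.inl) (Sum.elim Sum.inr (Sum.inl ∘ Sum.inr)))
        (by rintro _ _ (_ | _ | _) <;> rfl)
  · intro x
    constructor
    · rintro ⟨y, hy, hyx⟩
      exact ⟨y.1, y.2, (hφ y).1 hy, (hψ y x).1 hyx⟩
    · rintro ⟨y, hy, h1, h2⟩
      exact ⟨⟨y, hy⟩, (hφ ⟨y, hy⟩).2 h1, (hψ ⟨y, hy⟩ x).2 h2⟩

end IsDefinableOver

namespace IsDefinableRelOver

variable {A B : Set N} {R : SetRel (G.Points N) (G.Points N)}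

lemma iInter {ι : Type*} [Finite ι] {R : ι → SetRel (G.Points N) (G.Points N)}
    (hR : ∀ k, IsDefinableRelOver A (R k)) : IsDefinableRelOver A (⋂ k, R k) := by
  choose φ hφ using hR
  exact ⟨Formula.iInf φ, fun x y => by simp only [Formula.realize_iInf, mem_iInter, hφ]⟩

end IsDefinableRelOver

/-! ### Points over elementary substructures -/

section Group

variable [N ⊨ T] [Nonempty N]

variable (G) in
/-- The inclusion of `G(M)` into `G(N)`. -/
def inclusion (M : L.ElementarySubstructure N) : G.Points M →* G.Points N :=
  MonoidHom.mk' (fun x => ⟨M.subtype ∘ x.1, (M.subtype.map_formula G.dom x.1).2 x.2⟩)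
    fun x y => by
      refine (mul_eq ?_).symm
      have h := (M.subtype.map_formula G.mulGraph _).2 (realize_mul x y)
      simpa only [Sum.comp_elim] using h

lemma mem_pointsIn_iff {M : L.ElementarySubstructure N} {g : G.Points N} :
    g ∈ pointsIn (M : Set N) ↔ g ∈ (inclusion G M).range := by
  constructor
  · intro hg
    have h : (fun k => M.subtype (⟨g.1 k, hg k⟩ : M)) = g.1 := rfl
    refine ⟨⟨fun k => ⟨g.1 k, hg k⟩, (M.subtype.map_formula G.dom _).1 ?_⟩, rfl⟩
    exact g.2
  · rintro ⟨x, rfl⟩ k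
    exact (x.1 k).2

lemma one_mem_pointsIn (M : L.ElementarySubstructure N) :
    (1 : G.Points N) ∈ pointsIn (M : Set N) :=
  mem_pointsIn_iff.2 (one_mem _)

lemma inv_mem_pointsIn {M : L.ElementarySubstructure N} {g : G.Points N}
    (hg : g ∈ pointsIn (M : Set N)) : g⁻¹ ∈ pointsIn (M : Set N) :=
  mem_pointsIn_iff.2 (inv_mem (mem_pointsIn_iff.1 hg))

/-- Only the graph of the multiplication is given by a formula, so translates must be rewritten
through it, with bare tuples, before a formula can be read off. -/
lemma mem_smul_set_iff_exists {g x : G.Points N} {Y : Set (G.Points N)} :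
    x ∈ g • Y ↔ ∃ (y : Fin G.dim → N) (hy : G.dom.Realize y), (⟨y, hy⟩ : G.Points N) ∈ Y ∧
      G.mulGraph.Realize (Sum.elim g.1 (Sum.elim y x.1)) := by
  constructor
  · rintro ⟨y, hy, rfl⟩
    exact ⟨y.1, y.2, hy, realize_mul g y⟩
  · rintro ⟨y, hy, h1, h2⟩
    exact ⟨⟨y, hy⟩, h1, mul_eq h2⟩

lemma mem_smul_rel_iff_exists {g x y : G.Points N} {R : SetRel (G.Points N) (G.Points N)} :
    (x, y) ∈ g • R ↔ ∃ (x' y' : Fin G.dim → N) (hx : G.dom.Realize x') (hy : G.dom.Realize y'),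
      ((⟨x', hx⟩, ⟨y', hy⟩) : G.Points N × G.Points N) ∈ R ∧
      G.mulGraph.Realize (Sum.elim g.1 (Sum.elim x' x.1)) ∧
      G.mulGraph.Realize (Sum.elim g.1 (Sum.elim y' y.1)) := by
  constructor
  · rintro ⟨⟨x', y'⟩, h, h'⟩
    obtain ⟨rfl, rfl⟩ := Prod.mk.inj h'
    exact ⟨x'.1, y'.1, x'.2, y'.2, h, realize_mul g x', realize_mul g y'⟩
  · rintro ⟨x', y', hx, hy, h, h1, h2⟩
    exact ⟨(⟨x', hx⟩, ⟨y', hy⟩), h, Prod.ext (mul_eq h1) (mul_eq h2)⟩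

lemma IsDefinableOver.smul {A : Set N} {Y : Set (G.Points N)} (hY : IsDefinableOver A Y)
    {g : G.Points N} (hg : g ∈ pointsIn A) : IsDefinableOver A (g • Y) := by
  obtain ⟨φ, hφ⟩ := isDefinableOver_iff.1 hY
  refine of_isFirstOrder (P := fun N _ v => ∃ y : Fin G.dim → N, G.dom.Realize y ∧
    φ.Realize (Sum.elim (v ∘ Sum.inl) y) ∧
    G.mulGraph.Realize (Sum.elim (fun k => v (Sum.inl ⟨g.1 k, hg k⟩))
      (Sum.elim y (v ∘ Sum.inr)))) ?_ ?_
  · refine .exists_tuple (.and ?_ (.and ?_ ?_))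
    · exact .formula _ _ Sum.inr fun _ _ _ => rfl
    · exact .formula _ _ (Sum.elim (Sum.inl ∘ Sum.inl) Sum.inr) (by rintro _ _ (_ | _) <;> rfl)
    · exact .formula _ _ (Sum.elim (fun k => Sum.inl (Sum.inl ⟨g.1 k, hg k⟩))
        (Sum.elim Sum.inr (Sum.inl ∘ Sum.inr))) (by rintro _ _ (_ | _ | _) <;> rfl)
  · intro x
    rw [mem_smul_set_iff_exists]
    refine exists_congr fun y => ⟨?_, ?_⟩
    · rintro ⟨hy, h1, h2⟩
      exact ⟨hy, (hφ _).1 h1, h2⟩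
    · rintro ⟨hy, h1, h2⟩
      exact ⟨hy, (hφ ⟨y, hy⟩).2 h1, h2⟩

lemma IsDefinable.smul {Y : Set (G.Points N)} (hY : IsDefinable Y) (g : G.Points N) :
    IsDefinable (g • Y) :=
  IsDefinableOver.smul hY fun _ => mem_univ _

end Group

end DefinableGroup

end

end VeeAmenability

namespace VeeAmenability

noncomputable section

open Filter Topology DefinableGroup

variable {L : FirstOrder.Language.{u, v}} {T : L.Theory}

/-! ### Almost elementary maps between models of a complete theory -/

/-- Only finitely many variables occur in `φ`, so its existential closure is a sentence, and a
complete theory decides it the same way in all models. -/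
lemma exists_realize_of_isComplete (hT : T.IsComplete) {α : Type*} (φ : L.Formula α)
    {N : Type*} [L.Structure N] [N ⊨ T] [Nonempty N] {v : α → N} (h : φ.Realize v)
    (M : Type*) [L.Structure M] [M ⊨ T] [Nonempty M] : ∃ f : α → M, φ.Realize f := by
  classical
  have h1 : N ⊨ φ.exClosure := φ.realize_exClosure.2
    ⟨fun a => v a, (BoundedFormula.realize_restrictFreeVar (f := id) v fun _ => rfl).2 h⟩
  have h2 : M ⊨ φ.exClosure :=
    (hT.realize_sentence_iff _ M).2 ((hT.realize_sentence_iff _ N).1 h1)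
  obtain ⟨w, hw⟩ := φ.realize_exClosure.1 h2
  -- Variables that do not occur in `φ` may take any value.
  refine ⟨fun a => if ha : a ∈ φ.freeVarFinset then w ⟨a, ha⟩ else Classical.arbitrary M, ?_⟩
  exact (BoundedFormula.realize_restrictFreeVar (f := id) _ fun a => by
    rw [dif_pos a.2]; rfl).1 hw

/-- The formulas true of `id` are closed under conjunction, and each is realized by some `f`, so the
sets of their realizations generate a proper filter. Neither saturation nor a bound on cardinalities
is needed. -/
lemma exists_ultrafilter_eventually_realize (hT : T.IsComplete)
    (N : Type*) [L.Structure N] [N ⊨ T] [Nonempty N]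
    (M : Type*) [L.Structure M] [M ⊨ T] [Nonempty M] :
    ∃ U : Ultrafilter (N → M), ∀ φ : L.Formula N, φ.Realize (id : N → N) →
      ∀ᶠ f : N → M in U, φ.Realize f := by
  let F : {φ : L.Formula N // φ.Realize (id : N → N)} → Filter (N → M) :=
    fun φ => 𝓟 {f | φ.1.Realize f}
  have : Nonempty {φ : L.Formula N // φ.Realize (id : N → N)} := ⟨⟨⊤, by simp⟩⟩
  have hF : NeBot (iInf F) := by
    refine iInf_neBot_of_directed' ?_ fun φ => ?_
    · intro φ ψ
      refine ⟨⟨φ.1 ⊓ ψ.1, Formula.realize_inf.2 ⟨φ.2, ψ.2⟩⟩, ?_, ?_⟩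
      · exact principal_mono.2 fun f hf => (Formula.realize_inf.1 hf).1
      · exact principal_mono.2 fun f hf => (Formula.realize_inf.1 hf).2
    · exact principal_neBot_iff.2 (exists_realize_of_isComplete hT φ.1 φ.2 M)
  refine ⟨Ultrafilter.of (iInf F), fun φ hφ => ?_⟩
  exact (Ultrafilter.of_le _).trans (iInf_le F ⟨φ, hφ⟩) (mem_principal_self _)

/-- The maps take values in `M`, but truth is evaluated in `N₁`, where the definable sets to be
measured live; elementarity makes the two agree. -/
lemma exists_ultrafilter_eventually_isFirstOrder (hT : T.IsComplete)
    (N₂ : Type w) [L.Structure N₂] [N₂ ⊨ T] [Nonempty N₂]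
    {N₁ : Type w} [L.Structure N₁] [N₁ ⊨ T] [Nonempty N₁] (M : L.ElementarySubstructure N₁) :
    ∃ U : Ultrafilter (N₂ → N₁), (∀ᶠ f : N₂ → N₁ in U, ∀ a, f a ∈ (M : Set N₁)) ∧
      ∀ P : ∀ (N : Type w) [L.Structure N], (N₂ → N) → Prop, IsFirstOrder P → P N₂ id →
        ∀ᶠ f : N₂ → N₁ in U, P N₁ f := by
  obtain ⟨U, hU⟩ := exists_ultrafilter_eventually_realize hT N₂ M
  refine ⟨U.map fun f a => (f a : N₁), ?_, fun P hP hid => ?_⟩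
  · exact Filter.Eventually.of_forall (f := (U : Filter (N₂ → M))) fun f a => (f a).2
  · obtain ⟨φ, hφ⟩ := id hP
    have h := hU φ ((hφ N₂ id).2 hid)
    exact h.mono fun f hf => (hP.elementarySubstructure M f).1 ((hφ M f).1 hf)

/-! ### Definable families -/

namespace DefinableGroup

variable {G : DefinableGroup.{u, v, w} T} {κ : Type*}

variable (G) in
/-- The subset of `G(N)` defined by an instance of a formula. -/
def fiber {N : Type w} [L.Structure N] (φ : L.Formula (κ ⊕ Fin G.dim)) (f : κ → N) :
    Set (G.Points N) :=
  {x | φ.Realize (Sum.elim f x.1)}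

section

variable {N : Type w} [L.Structure N]

lemma mem_fiber {φ : L.Formula (κ ⊕ Fin G.dim)} {f : κ → N} {x : G.Points N} :
    x ∈ fiber G φ f ↔ φ.Realize (Sum.elim f x.1) := Iff.rfl

lemma fiber_sup (φ ψ : L.Formula (κ ⊕ Fin G.dim)) (f : κ → N) :
    fiber G (φ ⊔ ψ) f = fiber G φ f ∪ fiber G ψ f := by
  ext x
  simp only [mem_fiber, Formula.realize_sup, mem_union]

lemma fiber_bot (f : κ → N) : fiber G ⊥ f = ∅ := by
  ext x
  simp [mem_fiber]

lemma fiber_top (f : κ → N) : fiber G ⊤ f = Set.univ := by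
  ext x
  simp [mem_fiber]

lemma isDefinableOver_fiber (φ : L.Formula (κ ⊕ Fin G.dim)) {f : κ → N} {A : Set N}
    (hf : ∀ a, f a ∈ A) : IsDefinableOver A (fiber G φ f) := by
  refine .of_isFirstOrder (P := fun N _ v =>
    φ.Realize (Sum.elim (fun a => v (Sum.inl ⟨f a, hf a⟩)) (v ∘ Sum.inr)))
    (.formula _ _ (Sum.elim (fun a => Sum.inl ⟨f a, hf a⟩) Sum.inr)
      (by rintro _ _ (_ | _) <;> rfl)) fun x => Iff.rfl

/-- With every element of the model available as a variable, a definable set is a fiber at `id`, and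
its counterpart in another model is the fiber of the same formula at `f`. -/
lemma isDefinable_iff_exists_fiber {Y : Set (G.Points N)} :
    IsDefinable Y ↔ ∃ φ : L.Formula (N ⊕ Fin G.dim), Y = fiber G φ id := by
  constructor
  · intro h
    obtain ⟨φ, hφ⟩ := isDefinableOver_iff.1 h
    refine ⟨φ.relabel (Sum.map Subtype.val id), ?_⟩
    ext x
    rw [hφ, mem_fiber, Formula.realize_relabel, Sum.elim_comp_map]
    rfl
  · rintro ⟨φ, rfl⟩
    exact isDefinableOver_fiber φ fun _ => mem_univ _

end

lemma isFirstOrder_fiber_subset (φ ψ : L.Formula (κ ⊕ Fin G.dim)) :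
    IsFirstOrder (L := L) fun (N : Type w) _ (v : κ → N) => fiber G φ v ⊆ fiber G ψ v := by
  have h : IsFirstOrder (L := L) fun (N : Type w) _ (v : κ → N) => ∀ x : Fin G.dim → N,
      G.dom.Realize x → φ.Realize (Sum.elim v x) → ψ.Realize (Sum.elim v x) := by
    refine .forall_tuple (.imp ?_ (.imp ?_ ?_))
    · exact .formula _ _ Sum.inr fun _ _ _ => rfl
    · exact .formula _ _ id (by rintro _ _ (_ | _) <;> rfl)
    · exact .formula _ _ id (by rintro _ _ (_ | _) <;> rfl)
  obtain ⟨χ, hχ⟩ := h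
  refine ⟨χ, fun N _ v => (hχ N v).trans ?_⟩
  exact ⟨fun h x hx => h x.1 x.2 hx, fun h x hx hx' => h (a := ⟨x, hx⟩) hx'⟩

lemma isFirstOrder_fiber_eq (φ ψ : L.Formula (κ ⊕ Fin G.dim)) :
    IsFirstOrder (L := L) fun (N : Type w) _ (v : κ → N) => fiber G φ v = fiber G ψ v := by
  simp only [subset_antisymm_iff]
  exact (isFirstOrder_fiber_subset φ ψ).and (isFirstOrder_fiber_subset ψ φ)

/-- The formula `χ` defines the translate by `g` of the set defined by `φ`. -/
def DefinesTranslate (N : Type w) [L.Structure N] (φ χ : L.Formula (κ ⊕ Fin G.dim))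
    (g : Fin G.dim → N) (v : κ → N) : Prop :=
  ∀ x : Fin G.dim → N, G.dom.Realize x → (χ.Realize (Sum.elim v x) ↔
    ∃ y : Fin G.dim → N, G.dom.Realize y ∧ φ.Realize (Sum.elim v y) ∧
      G.mulGraph.Realize (Sum.elim g (Sum.elim y x)))

lemma isFirstOrder_definesTranslate (φ χ : L.Formula (κ ⊕ Fin G.dim)) (g : Fin G.dim → κ) :
    IsFirstOrder (L := L) fun (N : Type w) _ (v : κ → N) => DefinesTranslate N φ χ (v ∘ g) v := by
  refine .forall_tuple (.imp ?_ (.iff ?_ (.exists_tuple (.and ?_ (.and ?_ ?_)))))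
  · exact .formula _ _ Sum.inr fun _ _ _ => rfl
  · exact .formula _ _ id (by rintro _ _ (_ | _) <;> rfl)
  · exact .formula _ _ Sum.inr fun _ _ _ => rfl
  · exact .formula _ _ (Sum.elim (Sum.inl ∘ Sum.inl) Sum.inr) (by rintro _ _ (_ | _) <;> rfl)
  · exact .formula _ _ (Sum.elim (Sum.inl ∘ Sum.inl ∘ g) (Sum.elim Sum.inr (Sum.inl ∘ Sum.inr)))
      (by rintro _ _ (_ | _ | _) <;> rfl)

section

variable {N : Type w} [L.Structure N] [N ⊨ T] [Nonempty N]

lemma definesTranslate_iff {φ χ : L.Formula (κ ⊕ Fin G.dim)} {g : G.Points N} {v : κ → N} :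
    DefinesTranslate N φ χ g.1 v ↔ fiber G χ v = g • fiber G φ v := by
  constructor
  · intro h
    ext x
    rw [mem_smul_set_iff_exists, mem_fiber, h x.1 x.2]
    exact exists_congr fun y => ⟨fun ⟨h1, h2⟩ => ⟨h1, h2⟩, fun ⟨h1, h2⟩ => ⟨h1, h2⟩⟩
  · intro h x hx
    have h' : (⟨x, hx⟩ : G.Points N) ∈ fiber G χ v ↔ _ := (Set.ext_iff.1 h ⟨x, hx⟩).trans
      mem_smul_set_iff_exists
    refine h'.trans ?_
    exact exists_congr fun y => ⟨fun ⟨h1, h2⟩ => ⟨h1, h2⟩, fun ⟨h1, h2⟩ => ⟨h1, h2⟩⟩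

/-- The image of a point of `G` under a map between models, when it lies in `G`. -/
def mapPoint {N' : Type w} [L.Structure N'] (f : N' → N) (g : G.Points N') : G.Points N :=
  -- The default value `1` is harmless: for fixed `g`, almost every `f` keeps the image in `G`.
  open Classical in if h : G.dom.Realize (f ∘ g.1) then ⟨f ∘ g.1, h⟩ else 1

lemma mapPoint_val {N' : Type w} [L.Structure N'] {f : N' → N} {g : G.Points N'}
    (h : G.dom.Realize (f ∘ g.1)) : (mapPoint f g).1 = f ∘ g.1 :=
  congrArg Subtype.val (dif_pos h)

end

end DefinableGroup

namespace VeeFamily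

variable {G : DefinableGroup.{u, v, w} T} {I : Type z} [Preorder I] (E : VeeFamily G I)

/-! ### Separation by finitely many translated instances as a first-order condition -/

section Separated

variable {κ : Type*} {n : ℕ}

/-- The sets defined by `φ` and `ψ` are separated by the intersection of the translates by `g k`
of the instances with parameters `b k`. -/
def Separated (N : Type w) [L.Structure N] (φ ψ : L.Formula (κ ⊕ Fin G.dim)) (i : I)
    (g : Fin n → Fin G.dim → N) (b : Fin n → Fin (E.arity i) → N) (v : κ → N) : Prop :=
  ∀ x y : Fin G.dim → N, G.dom.Realize x → G.dom.Realize y → φ.Realize (Sum.elim v x) →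
    ψ.Realize (Sum.elim v y) → ¬ ∀ k, ∃ x' y' : Fin G.dim → N, G.dom.Realize x' ∧
      G.dom.Realize y' ∧ (E.form i).Realize (Sum.elim x' (Sum.elim y' (b k))) ∧
      G.mulGraph.Realize (Sum.elim (g k) (Sum.elim x' x)) ∧
      G.mulGraph.Realize (Sum.elim (g k) (Sum.elim y' y))

/-- This makes the hypothesis of additivity transferable: `i` and `n` are fixed, while the
coordinates of the group elements and the parameters are variables of one formula. -/
lemma isFirstOrder_separated (φ ψ : L.Formula (κ ⊕ Fin G.dim)) (i : I)
    (g : Fin n → Fin G.dim → κ) (b : Fin n → Fin (E.arity i) → κ) :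
    IsFirstOrder (L := L) fun (N : Type w) _ (v : κ → N) =>
      E.Separated N φ ψ i (fun k => v ∘ g k) (fun k => v ∘ b k) v := by
  refine .forall_tuple (.forall_tuple (.imp ?_ (.imp ?_ (.imp ?_ (.imp ?_ (.not (.iAnd fun k =>
    .exists_tuple (.exists_tuple (.and ?_ (.and ?_ (.and ?_ (.and ?_ ?_))))))))))))
  · exact .formula _ _ (Sum.inl ∘ Sum.inr) fun _ _ _ => rfl
  · exact .formula _ _ Sum.inr fun _ _ _ => rfl
  · exact .formula _ _ Sum.inl (by rintro _ _ (_ | _) <;> rfl)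
  · exact .formula _ _ (Sum.elim (Sum.inl ∘ Sum.inl) Sum.inr) (by rintro _ _ (_ | _) <;> rfl)
  · exact .formula _ _ (Sum.inl ∘ Sum.inr) fun _ _ _ => rfl
  · exact .formula _ _ Sum.inr fun _ _ _ => rfl
  · exact .formula _ _ (Sum.elim (Sum.inl ∘ Sum.inr) (Sum.elim Sum.inr
      (Sum.inl ∘ Sum.inl ∘ Sum.inl ∘ Sum.inl ∘ b k))) (by rintro _ _ (_ | _ | _) <;> rfl)
  · exact .formula _ _ (Sum.elim (Sum.inl ∘ Sum.inl ∘ Sum.inl ∘ Sum.inl ∘ g k)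
      (Sum.elim (Sum.inl ∘ Sum.inr) (Sum.inl ∘ Sum.inl ∘ Sum.inl ∘ Sum.inr)))
      (by rintro _ _ (_ | _ | _) <;> rfl)
  · exact .formula _ _ (Sum.elim (Sum.inl ∘ Sum.inl ∘ Sum.inl ∘ Sum.inl ∘ g k)
      (Sum.elim Sum.inr (Sum.inl ∘ Sum.inl ∘ Sum.inr)))
      (by rintro _ _ (_ | _ | _) <;> rfl)

variable {E} in
lemma separated_iff {N : Type w} [L.Structure N] [N ⊨ T] [Nonempty N]
    {φ ψ : L.Formula (κ ⊕ Fin G.dim)} {i : I} {g : Fin n → G.Points N}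
    {b : Fin n → Fin (E.arity i) → N} {v : κ → N} :
    E.Separated N φ ψ i (fun k => (g k).1) b v ↔
      SetRel.image (⋂ k, g k • E.inst i (b k)) (fiber G φ v) ∩ fiber G ψ v = ∅ := by
  rw [← disjoint_iff_inter_eq_empty, Set.disjoint_left]
  constructor
  · rintro h y ⟨x, hx, hxy⟩ hy
    refine h x.1 y.1 x.2 y.2 hx hy fun k => ?_
    obtain ⟨x', y', hx', hy', h1, h2⟩ := mem_smul_rel_iff_exists.1 (mem_iInter.1 hxy k)
    exact ⟨x', y', hx', hy', h1, h2⟩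
  · intro h x y hx hy hxφ hyψ hk
    refine h (a := ⟨y, hy⟩) ⟨⟨x, hx⟩, hxφ, mem_iInter.2 fun k => ?_⟩ hyψ
    obtain ⟨x', y', hx', hy', h1, h2⟩ := hk k
    exact mem_smul_rel_iff_exists.2 ⟨x', y', hx', hy', h1, h2⟩

end Separated

/-! ### Transfer of pre-means -/

section Transfer

/-- A function on the sets definable over `M` which has the properties of a `G(M)`-invariant
`G`-pre-mean for translations by elements of `G(M)`. -/
structure IsLocalPreMean {N : Type w} [L.Structure N] [N ⊨ T] [Nonempty N] (M : Set N)
    (m : Set (G.Points N) → ℝ) : Prop where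
  mem_Icc : ∀ Y, IsDefinableOver M Y → m Y ∈ Set.Icc (0 : ℝ) 1
  empty : m ∅ = 0
  univ : m Set.univ = 1
  monotone : ∀ Y Z, IsDefinableOver M Y → IsDefinableOver M Z → Y ⊆ Z → m Y ≤ m Z
  union_le : ∀ Y Z, IsDefinableOver M Y → IsDefinableOver M Z → m (Y ∪ Z) ≤ m Y + m Z
  union_eq : ∀ Y Z, IsDefinableOver M Y → IsDefinableOver M Z →
    ∀ (i : I) (n : ℕ) (g : Fin n → G.Points N) (b : Fin n → Fin (E.arity i) → N),
      (∀ k, g k ∈ pointsIn M) → (∀ k l, b k l ∈ M) →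
      SetRel.image (⋂ k, g k • E.inst i (b k)) Y ∩ Z = ∅ → m (Y ∪ Z) = m Y + m Z
  smul : ∀ g ∈ pointsIn (G := G) M, ∀ Y, IsDefinableOver M Y → m (g • Y) = m Y

variable {E} {N₁ N₂ : Type w} [L.Structure N₁] [L.Structure N₂] [N₁ ⊨ T] [N₂ ⊨ T]
  [Nonempty N₁] [Nonempty N₂]

/-- Each axiom for the limit needs only finitely many first-order facts about the sets involved.
These hold for almost every `f`, where the corresponding property of `m₁` applies, and closed
conditions on reals pass to limits. -/
theorem IsLocalPreMean.exists_isGPreMean (hT : T.IsComplete) {M : L.ElementarySubstructure N₁}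
    {m₁ : Set (G.Points N₁) → ℝ} (hm : E.IsLocalPreMean (M : Set N₁) m₁) :
    ∃ m : Set (G.Points N₂) → ℝ, E.IsGPreMean Set.univ m ∧
      ∀ (g : G.Points N₂) (Y : Set (G.Points N₂)), IsDefinable Y → m (g • Y) = m Y := by
  obtain ⟨U, hUM, hU⟩ := exists_ultrafilter_eventually_isFirstOrder hT N₂ M
  have hdef : ∀ φ : L.Formula (N₂ ⊕ Fin G.dim), ∀ᶠ f : N₂ → N₁ in U,
      IsDefinableOver (M : Set N₁) (fiber G φ f) := fun φ =>
    hUM.mono fun f hf => isDefinableOver_fiber φ hf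
  have hlim : ∀ φ : L.Formula (N₂ ⊕ Fin G.dim), ∃ l : ℝ,
      Tendsto (fun f => m₁ (fiber G φ f)) U (𝓝 l) := fun φ => by
    obtain ⟨l, -, hl⟩ := (isCompact_Icc (a := (0 : ℝ)) (b := 1)).ultrafilter_le_nhds
      (U.map fun f => m₁ (fiber G φ f))
      (le_principal_iff.2 ((hdef φ).mono fun f hf => hm.mem_Icc _ hf))
    exact ⟨l, hl⟩
  choose l hl using hlim
  classical
  -- A defining formula is chosen arbitrarily; `key` shows that the limit does not depend on it,
  -- since two formulas with the same fiber at `id` have the same fiber at almost every `f`.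
  let m : Set (G.Points N₂) → ℝ := fun Y =>
    if h : ∃ φ : L.Formula (N₂ ⊕ Fin G.dim), Y = fiber G φ id then l h.choose else 0
  have key : ∀ φ : L.Formula (N₂ ⊕ Fin G.dim),
      Tendsto (fun f => m₁ (fiber G φ f)) U (𝓝 (m (fiber G φ id))) := fun φ => by
    have h : ∃ ψ : L.Formula (N₂ ⊕ Fin G.dim), fiber G φ (id : N₂ → N₂) = fiber G ψ id := ⟨φ, rfl⟩
    have h1 : m (fiber G φ id) = l h.choose := dif_pos h
    rw [h1]
    refine (hl h.choose).congr' ?_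
    filter_upwards [hU _ (isFirstOrder_fiber_eq φ h.choose) h.choose_spec] with f hf
    rw [hf]
  have hpt : ∀ g : G.Points N₂, ∀ᶠ f : N₂ → N₁ in U,
      (mapPoint f g : G.Points N₁).1 = f ∘ g.1 := fun g => by
    have h : IsFirstOrder (L := L) fun (N : Type w) _ (v : N₂ → N) => G.dom.Realize (v ∘ g.1) :=
      .formula _ _ g.1 fun _ _ _ => rfl
    filter_upwards [hU _ h g.2] with f hf
    exact mapPoint_val hf
  have hptM : ∀ g : G.Points N₂, ∀ᶠ f : N₂ → N₁ in U,
      (mapPoint f g : G.Points N₁) ∈ pointsIn (M : Set N₁) := fun g => by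
    filter_upwards [hpt g, hUM] with f hf hfM k
    rw [hf]
    exact hfM _
  have hsub : ∀ φ ψ : L.Formula (N₂ ⊕ Fin G.dim), fiber G φ (id : N₂ → N₂) ⊆ fiber G ψ id →
      ∀ᶠ f : N₂ → N₁ in U, fiber (N := N₁) G φ f ⊆ fiber G ψ f := fun φ ψ h =>
    hU _ (isFirstOrder_fiber_subset φ ψ) h
  refine ⟨m, ⟨?_, ?_, ?_, ?_, ?_, ?_⟩, ?_⟩
  · intro Y hY
    obtain ⟨φ, rfl⟩ := isDefinable_iff_exists_fiber.1 hY
    exact isClosed_Icc.mem_of_tendsto (key φ) ((hdef φ).mono fun f hf => hm.mem_Icc _ hf)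
  · have h := key ⊥
    simp only [fiber_bot, hm.empty] at h
    exact (tendsto_nhds_unique h tendsto_const_nhds)
  · have h := key ⊤
    simp only [fiber_top, hm.univ] at h
    exact (tendsto_nhds_unique h tendsto_const_nhds)
  · intro Y Z hY hZ hYZ
    obtain ⟨φ, rfl⟩ := isDefinable_iff_exists_fiber.1 hY
    obtain ⟨ψ, rfl⟩ := isDefinable_iff_exists_fiber.1 hZ
    refine le_of_tendsto_of_tendsto (key φ) (key ψ) ?_
    filter_upwards [hdef φ, hdef ψ, hsub φ ψ hYZ] with f h1 h2 h3
    exact hm.monotone _ _ h1 h2 h3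
  · intro Y Z hY hZ
    obtain ⟨φ, rfl⟩ := isDefinable_iff_exists_fiber.1 hY
    obtain ⟨ψ, rfl⟩ := isDefinable_iff_exists_fiber.1 hZ
    rw [← fiber_sup]
    refine le_of_tendsto_of_tendsto (key (φ ⊔ ψ)) ((key φ).add (key ψ)) ?_
    filter_upwards [hdef φ, hdef ψ] with f h1 h2
    rw [fiber_sup]
    exact hm.union_le _ _ h1 h2
  · intro Y Z hY hZ i n g b _ hYZ
    obtain ⟨φ, rfl⟩ := isDefinable_iff_exists_fiber.1 hY
    obtain ⟨ψ, rfl⟩ := isDefinable_iff_exists_fiber.1 hZ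
    rw [← fiber_sup]
    refine tendsto_nhds_unique (key (φ ⊔ ψ)) (((key φ).add (key ψ)).congr' ?_)
    -- The separating data are arbitrary in `N₂`; their images under almost every `f` lie in `G(M)`
    -- and in `M`, as the local additivity requires.
    have h := hU _ (E.isFirstOrder_separated φ ψ i (fun k => (g k).1) b) (separated_iff.2 hYZ)
    filter_upwards [hdef φ, hdef ψ, h, eventually_all.2 fun k => hpt (g k),
      eventually_all.2 fun k => hptM (g k), hUM] with f h1 h2 h3 h4 h5 h6
    simp only [← h4] at h3
    rw [fiber_sup]
    exact (hm.union_eq _ _ h1 h2 i n _ _ h5 (fun k l => h6 (b k l)) (separated_iff.1 h3)).symm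
  · intro g Y hY
    obtain ⟨φ, rfl⟩ := isDefinable_iff_exists_fiber.1 hY
    obtain ⟨χ, hχ⟩ := isDefinable_iff_exists_fiber.1 (hY.smul g)
    rw [hχ]
    refine tendsto_nhds_unique (key χ) ((key φ).congr' ?_)
    have h := hU _ (isFirstOrder_definesTranslate φ χ g.1) (definesTranslate_iff.2 hχ.symm)
    filter_upwards [hdef φ, h, hpt g, hptM g] with f h1 h2 h3 h4
    rw [← h3, definesTranslate_iff] at h2
    rw [h2, hm.smul _ h4 _ h1]

/-- A pre-mean which is invariant under `G(M)` is in particular a local one. -/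
lemma IsGPreMean.isLocalPreMean {M : Set N₁} {m : Set (G.Points N₁) → ℝ} (hm : E.IsGPreMean M m)
    (hinv : ∀ g ∈ pointsIn (G := G) M, ∀ Y, IsDefinable Y → m (g • Y) = m Y) :
    E.IsLocalPreMean M m where
  mem_Icc Y hY := hm.mem_Icc Y hY.isDefinable
  empty := hm.empty
  univ := hm.univ
  monotone Y Z hY hZ := hm.monotone Y Z hY.isDefinable hZ.isDefinable
  union_le Y Z hY hZ := hm.union_le Y Z hY.isDefinable hZ.isDefinable
  union_eq Y Z hY hZ i n g b _ := hm.union_eq Y Z hY.isDefinable hZ.isDefinable i n g b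
  smul g hg Y hY := hinv g hg Y hY.isDefinable

lemma IsGPreMean.mono {M M' : Set N₁} {m : Set (G.Points N₁) → ℝ} (hm : E.IsGPreMean M' m)
    (hM : M ⊆ M') : E.IsGPreMean M m :=
  { hm with
    union_eq := fun Y Z hY hZ i n g b hb =>
      hm.union_eq Y Z hY hZ i n g b fun k l => hM (hb k l) }

lemma IsLocalPreMean.hasInvariantGPreMean (hT : T.IsComplete) {M : L.ElementarySubstructure N₁}
    {m₁ : Set (G.Points N₁) → ℝ} (hm : E.IsLocalPreMean (M : Set N₁) m₁) (M₂ : Set N₂) :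
    E.HasInvariantGPreMean M₂ Set.univ := by
  obtain ⟨m, h1, h2⟩ := hm.exists_isGPreMean (N₂ := N₂) hT
  exact ⟨m, h1.mono (subset_univ _), fun g _ => h2 g⟩

end Transfer

end VeeFamily

end

end VeeAmenability

namespace VeeAmenability

noncomputable section

open DefinableGroup

variable {L : FirstOrder.Language.{u, v}} {T : L.Theory}

/-! ### Compactness in saturated models -/

section Saturated

variable {κ : Cardinal.{w}} {N : Type w} [L.Structure N]

lemma exists_subset_of_finset {α β : Type*} {𝒮 : Set (Set α)} (hne : 𝒮.Nonempty)
    (hdir : DirectedOn (· ⊇ ·) 𝒮) (p : Finset β) (f : β → Set α)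
    (hf : ∀ φ ∈ p, ∃ S ∈ 𝒮, S ⊆ f φ) : ∃ S ∈ 𝒮, ∀ φ ∈ p, S ⊆ f φ := by
  classical
  induction p using Finset.induction_on with
  | empty => exact ⟨hne.some, hne.some_mem, by simp⟩
  | insert φ p _ ih =>
    obtain ⟨S, hS, h⟩ := ih fun ψ hψ => hf ψ (Finset.mem_insert_of_mem hψ)
    obtain ⟨S', hS', h'⟩ := hf φ (Finset.mem_insert_self _ _)
    obtain ⟨R, hR, h1, h2⟩ := hdir S hS S' hS'
    refine ⟨R, hR, fun ψ hψ => ?_⟩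
    rcases Finset.mem_insert.1 hψ with rfl | hψ
    · exact Subset.trans h2 h'
    · exact Subset.trans h1 (h ψ hψ)

/-- Directedness supplies finite satisfiability: finitely many of the defining formulas all hold on
one member of the family. -/
lemma IsSaturated.sInter_nonempty (hN : IsSaturated L κ N) {A : Set N} (hA : #A < κ) {β : Type*}
    [Finite β] {𝒮 : Set (Set (β → N))} (hne : 𝒮.Nonempty) (hdir : DirectedOn (· ⊇ ·) 𝒮)
    (hdef : ∀ S ∈ 𝒮, A.Definable L S) (hS : ∀ S ∈ 𝒮, S.Nonempty) : (⋂₀ 𝒮).Nonempty := by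
  obtain ⟨n, ⟨e⟩⟩ := Finite.exists_equiv_fin β
  obtain ⟨a, ha⟩ := hN A hA n {φ | ∃ S ∈ 𝒮, ∀ a : Fin n → N, φ.Realize a ↔ a ∘ e ∈ S} (by
    intro p₀ hp₀
    obtain ⟨S, hS', h⟩ := exists_subset_of_finset hne hdir p₀
      (fun φ => {a | φ.Realize (a ∘ e.symm)}) (fun φ hφ => by
        obtain ⟨S, hS, h⟩ := hp₀ hφ
        refine ⟨S, hS, fun a ha => (h _).2 ?_⟩
        rwa [Function.comp_assoc, e.symm_comp_self])
    obtain ⟨a, ha⟩ := hS S hS'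
    exact ⟨a ∘ e.symm, fun φ hφ => h φ hφ ha⟩)
  refine ⟨a ∘ e, fun S hS => ?_⟩
  obtain ⟨φ, hφ⟩ := (hdef S hS).preimage_comp e
  have h : ∀ a : Fin n → N, φ.Realize a ↔ a ∘ e ∈ S := fun a => (Set.ext_iff.1 hφ a).symm
  exact (h a).1 (ha φ ⟨S, hS, h⟩)

end Saturated

lemma IsMonster.mk_union_lt {κ : Cardinal.{w}} {N : Type w} [L.Structure N]
    (hN : IsMonster L κ N) {A B : Set N} (hA : #A < κ) (hB : #B < κ) : #(A ∪ B : Set N) < κ :=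
  (mk_union_le A B).trans_lt (add_lt_of_lt hN.aleph0_lt.le hA hB)

/-! ### Type-definable sets and compactness in `G(N)` -/

namespace DefinableGroup

variable {G : DefinableGroup.{u, v, w} T} {κ : Cardinal.{w}} {N : Type w} [L.Structure N]

/-- A subset of `G(N)` is an intersection of sets definable over `A`. -/
def IsTypeDefinableOver (A : Set N) (Y : Set (G.Points N)) : Prop :=
  ∀ x ∉ Y, ∃ D, IsDefinableOver A D ∧ Y ⊆ D ∧ x ∉ D

/-- The sets definable over `A` which contain `Y`. -/
def definableSupersets (A : Set N) (Y : Set (G.Points N)) : Set (Set (G.Points N)) :=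
  {D | IsDefinableOver A D ∧ Y ⊆ D}

lemma definableSupersets_nonempty (A : Set N) (Y : Set (G.Points N)) :
    (definableSupersets A Y).Nonempty :=
  ⟨Set.univ, .univ, subset_univ Y⟩

lemma directedOn_definableSupersets (A : Set N) (Y : Set (G.Points N)) :
    DirectedOn (· ⊇ ·) (definableSupersets A Y) := fun D hD D' hD' =>
  ⟨D ∩ D', ⟨hD.1.inter hD'.1, subset_inter hD.2 hD'.2⟩, inter_subset_left, inter_subset_right⟩

namespace IsTypeDefinableOver

variable {A B : Set N} {Y Z : Set (G.Points N)}

lemma sInter_definableSupersets (hY : IsTypeDefinableOver A Y) :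
    ⋂₀ definableSupersets A Y = Y := by
  refine Subset.antisymm (fun x hx => ?_) (subset_sInter fun D hD => hD.2)
  by_contra h
  obtain ⟨D, hD, h1, h2⟩ := hY x h
  exact h2 (hx D ⟨hD, h1⟩)

lemma mono (hY : IsTypeDefinableOver A Y) (hAB : A ⊆ B) : IsTypeDefinableOver B Y := fun x hx =>
  let ⟨D, hD, h⟩ := hY x hx
  ⟨D, hD.mono hAB, h⟩

lemma inter (hY : IsTypeDefinableOver A Y) (hZ : IsTypeDefinableOver A Z) :
    IsTypeDefinableOver A (Y ∩ Z) := by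
  intro x hx
  by_cases h : x ∈ Y
  · obtain ⟨D, hD, h1, h2⟩ := hZ x fun h' => hx ⟨h, h'⟩
    exact ⟨D, hD, inter_subset_right.trans h1, h2⟩
  · obtain ⟨D, hD, h1, h2⟩ := hY x h
    exact ⟨D, hD, inter_subset_left.trans h1, h2⟩

lemma union (hY : IsTypeDefinableOver A Y) (hZ : IsTypeDefinableOver A Z) :
    IsTypeDefinableOver A (Y ∪ Z) := by
  intro x hx
  rw [mem_union, not_or] at hx
  obtain ⟨D, hD, h1, h2⟩ := hY x hx.1
  obtain ⟨F, hF, h3, h4⟩ := hZ x hx.2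
  exact ⟨D ∪ F, hD.union hF, union_subset_union h1 h3, fun h => h.elim h2 h4⟩

lemma smul [N ⊨ T] [Nonempty N] {g : G.Points N} (hg : g ∈ pointsIn A)
    (hY : IsTypeDefinableOver A Y) : IsTypeDefinableOver A (g • Y) := by
  intro x hx
  rw [mem_smul_set_iff_inv_smul_mem] at hx
  obtain ⟨D, hD, h1, h2⟩ := hY _ hx
  exact ⟨g • D, hD.smul hg, smul_set_mono h1, fun h => h2 (mem_smul_set_iff_inv_smul_mem.1 h)⟩

end IsTypeDefinableOver

lemma IsDefinableOver.isTypeDefinableOver {A : Set N} {Y : Set (G.Points N)}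
    (hY : IsDefinableOver A Y) : IsTypeDefinableOver A Y := fun _ hx => ⟨Y, hY, Subset.rfl, hx⟩

lemma isTypeDefinable_iff {Y : Set (G.Points N)} :
    IsTypeDefinable κ Y ↔ ∃ A : Set N, #A < κ ∧ IsTypeDefinableOver A Y := by
  constructor
  · rintro ⟨A, hA, S, hS, rfl⟩
    refine ⟨A, hA, fun x hx => ?_⟩
    simp only [mem_sInter, not_forall] at hx
    obtain ⟨D, hD, hx⟩ := hx
    exact ⟨D, hS D hD, sInter_subset_of_mem hD, hx⟩
  · rintro ⟨A, hA, hY⟩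
    exact ⟨A, hA, _, fun D hD => hD.1, hY.sInter_definableSupersets.symm⟩

lemma exists_params_finite {n : ℕ} (hκ : ℵ₀ < κ) (g : Fin n → G.Points N) :
    ∃ A : Set N, #A < κ ∧ ∀ k, g k ∈ pointsIn A :=
  ⟨Set.range fun p : Fin n × Fin G.dim => (g p.1).1 p.2,
    ((Set.finite_range _).lt_aleph0).trans hκ, fun k l => ⟨(k, l), rfl⟩⟩

/-- A formula mentions finitely many parameters. This keeps parameter sets below `κ` when a
definable set with arbitrary parameters enters a compactness argument. -/
lemma exists_finite_isDefinableOver {Y : Set (G.Points N)} (hY : IsDefinable Y) :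
    ∃ A : Set N, A.Finite ∧ IsDefinableOver A Y := by
  classical
  obtain ⟨φ, rfl⟩ := isDefinable_iff_exists_fiber.1 hY
  refine ⟨Sum.inl ⁻¹' (φ.freeVarFinset : Set (N ⊕ Fin G.dim)),
    φ.freeVarFinset.finite_toSet.preimage Sum.inl_injective.injOn, ?_⟩
  refine isDefinableOver_iff.2 ⟨BoundedFormula.restrictFreeVar φ fun a => match a with
    | ⟨Sum.inl a, ha⟩ => Sum.inl ⟨a, ha⟩
    | ⟨Sum.inr k, _⟩ => Sum.inr k, fun x => ?_⟩
  refine (BoundedFormula.realize_restrictFreeVar _ ?_).symm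
  rintro ⟨_ | _, _⟩ <;> rfl

/-- Compactness for sets of the form `R ∘ Y ∩ Z`. -/
lemma exists_image_inter_eq_empty (hN : IsSaturated L κ N) {A : Set N} (hA : #A < κ)
    {𝓡 : Set (SetRel (G.Points N) (G.Points N))} {𝓨 𝓩 : Set (Set (G.Points N))}
    (hR : 𝓡.Nonempty) (hY : 𝓨.Nonempty) (hZ : 𝓩.Nonempty)
    (hR' : DirectedOn (· ⊇ ·) 𝓡) (hY' : DirectedOn (· ⊇ ·) 𝓨) (hZ' : DirectedOn (· ⊇ ·) 𝓩)
    (hRdef : ∀ R ∈ 𝓡, IsDefinableRelOver A R) (hYdef : ∀ Y ∈ 𝓨, IsDefinableOver A Y)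
    (hZdef : ∀ Z ∈ 𝓩, IsDefinableOver A Z)
    (h : SetRel.image (⋂₀ 𝓡) (⋂₀ 𝓨) ∩ ⋂₀ 𝓩 = ∅) :
    ∃ R ∈ 𝓡, ∃ Y ∈ 𝓨, ∃ Z ∈ 𝓩, SetRel.image R Y ∩ Z = ∅ := by
  by_contra! hcon
  -- `S R Y Z` collects the pairs witnessing that `R ∘ Y` meets `Z`, coded as single tuples. If no
  -- choice separates, these sets form a directed family of nonempty definable sets, and a common
  -- point contradicts `h`.
  let S : SetRel (G.Points N) (G.Points N) → Set (G.Points N) → Set (G.Points N) →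
      Set (Fin G.dim ⊕ Fin G.dim → N) := fun R Y Z =>
    {v | ∃ y x : G.Points N, v = Sum.elim y.1 x.1 ∧ y ∈ Y ∧ (y, x) ∈ R ∧ x ∈ Z}
  obtain ⟨v, hv⟩ := hN.sInter_nonempty hA (𝒮 := {s | ∃ R ∈ 𝓡, ∃ Y ∈ 𝓨, ∃ Z ∈ 𝓩, s = S R Y Z})
    ⟨_, hR.some, hR.some_mem, hY.some, hY.some_mem, hZ.some, hZ.some_mem, rfl⟩
    (by
      rintro _ ⟨R, hR, Y, hY, Z, hZ, rfl⟩ _ ⟨R', hR₁, Y', hY₁, Z', hZ₁, rfl⟩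
      obtain ⟨R₂, hR₂, h1, h1'⟩ := hR' R hR R' hR₁
      obtain ⟨Y₂, hY₂, h2, h2'⟩ := hY' Y hY Y' hY₁
      obtain ⟨Z₂, hZ₂, h3, h3'⟩ := hZ' Z hZ Z' hZ₁
      refine ⟨_, ⟨R₂, hR₂, Y₂, hY₂, Z₂, hZ₂, rfl⟩, ?_, ?_⟩
      · rintro _ ⟨y, x, rfl, hy, hyx, hx⟩
        exact ⟨y, x, rfl, h2 hy, h1 hyx, h3 hx⟩
      · rintro _ ⟨y, x, rfl, hy, hyx, hx⟩
        exact ⟨y, x, rfl, h2' hy, h1' hyx, h3' hx⟩)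
    (by
      rintro _ ⟨R, hR, Y, hY, Z, hZ, rfl⟩
      obtain ⟨φ, hφ⟩ := isDefinableOver_iff.1 (hYdef Y hY)
      obtain ⟨χ, hχ⟩ := hRdef R hR
      obtain ⟨ψ, hψ⟩ := isDefinableOver_iff.1 (hZdef Z hZ)
      rw [definable_iff_exists_formula_sum]
      refine ⟨(G.dom.relabel (Sum.inr ∘ Sum.inl) ⊓ G.dom.relabel (Sum.inr ∘ Sum.inr)) ⊓
        (φ.relabel (Sum.map id Sum.inl) ⊓ (χ ⊓ ψ.relabel (Sum.map id Sum.inr))), ?_⟩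
      ext v
      obtain ⟨y, x, rfl⟩ : ∃ y x, v = Sum.elim y x := ⟨_, _, (Sum.elim_comp_inl_inr v).symm⟩
      simp only [mem_ofPred_eq, Formula.realize_inf, Formula.realize_relabel, Sum.elim_comp_map,
        Function.comp_id, Sum.elim_comp_inl, Sum.elim_comp_inr, ← Function.comp_assoc]
      constructor
      · rintro ⟨y', x', h, h1, h2, h3⟩
        obtain ⟨rfl, rfl⟩ : y = y'.1 ∧ x = x'.1 :=
          ⟨funext fun k => congrFun h (Sum.inl k), funext fun k => congrFun h (Sum.inr k)⟩
        exact ⟨⟨y'.2, x'.2⟩, (hφ y').1 h1, (hχ y' x').1 h2, (hψ x').1 h3⟩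
      · rintro ⟨⟨hy, hx⟩, h1, h2, h3⟩
        exact ⟨⟨y, hy⟩, ⟨x, hx⟩, rfl, (hφ ⟨y, hy⟩).2 h1, (hχ ⟨y, hy⟩ ⟨x, hx⟩).2 h2,
          (hψ ⟨x, hx⟩).2 h3⟩)
    (by
      rintro _ ⟨R, hR, Y, hY, Z, hZ, rfl⟩
      obtain ⟨x, ⟨y, hy, hyx⟩, hx⟩ := hcon R hR Y hY Z hZ
      exact ⟨_, y, x, rfl, hy, hyx, hx⟩)
  have hv' : ∀ R ∈ 𝓡, ∀ Y ∈ 𝓨, ∀ Z ∈ 𝓩, v ∈ S R Y Z := fun R hR Y hY Z hZ =>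
    hv _ ⟨R, hR, Y, hY, Z, hZ, rfl⟩
  obtain ⟨y, x, hyx, -⟩ := hv' _ hR.some_mem _ hY.some_mem _ hZ.some_mem
  have key : ∀ R ∈ 𝓡, ∀ Y ∈ 𝓨, ∀ Z ∈ 𝓩, y ∈ Y ∧ (y, x) ∈ R ∧ x ∈ Z := fun R hR Y hY Z hZ => by
    obtain ⟨y', x', h, h'⟩ := hv' R hR Y hY Z hZ
    rw [hyx] at h
    obtain rfl : y = y' := Subtype.ext (funext fun k => congrFun h (Sum.inl k))
    obtain rfl : x = x' := Subtype.ext (funext fun k => congrFun h (Sum.inr k))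
    exact h'
  refine (Set.eq_empty_iff_forall_notMem.1 h) x ⟨⟨y, fun Y hY => ?_, fun R hR => ?_⟩,
    fun Z hZ => ?_⟩
  · exact (key _ hR.some_mem Y hY _ hZ.some_mem).1
  · exact (key R hR _ hY.some_mem _ hZ.some_mem).2.1
  · exact (key _ hR.some_mem _ hY.some_mem Z hZ).2.2

lemma IsDefinableOver.singleton {A : Set N} {x : G.Points N} (hx : x ∈ pointsIn A) :
    IsDefinableOver A {x} := by
  refine isDefinableOver_iff.2 ⟨Formula.iInf fun k : Fin G.dim =>
    Term.equal (Term.var (Sum.inr k)) (Term.var (Sum.inl ⟨x.1 k, hx k⟩)), fun y => ?_⟩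
  simp only [Formula.realize_iInf, Formula.realize_equal, Term.realize_var, Sum.elim_inr,
    Sum.elim_inl, mem_singleton_iff]
  exact ⟨fun h k => h ▸ rfl, fun h => Subtype.ext (funext h)⟩

lemma isDefinableRelOver_univ {A : Set N} :
    IsDefinableRelOver A (Set.univ : SetRel (G.Points N) (G.Points N)) :=
  ⟨⊤, fun x y => by simp⟩

/-- The preceding compactness statement with the full relation for `R` and the whole group for `Z`.
-/
lemma exists_mem_sInter (hN : IsSaturated L κ N) {A : Set N} (hA : #A < κ)
    {𝓨 : Set (Set (G.Points N))} (hY : 𝓨.Nonempty) (hY' : DirectedOn (· ⊇ ·) 𝓨)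
    (hYdef : ∀ Y ∈ 𝓨, IsDefinableOver A Y) (hne : ∀ Y ∈ 𝓨, Y.Nonempty) : (⋂₀ 𝓨).Nonempty := by
  by_contra! h
  obtain ⟨R, hR, Y, hYm, Z, hZ, h'⟩ := exists_image_inter_eq_empty hN hA
    (𝓡 := {Set.univ}) (𝓨 := 𝓨) (𝓩 := {Set.univ}) (singleton_nonempty _) hY (singleton_nonempty _)
    (directedOn_singleton _) hY' (directedOn_singleton _)
    (by rintro _ rfl; exact isDefinableRelOver_univ) hYdef (by rintro _ rfl; exact .univ)
    (by rw [h]; simp)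
  obtain ⟨y, hy⟩ := hne Y hYm
  rw [mem_singleton_iff] at hR hZ
  subst hR hZ
  exact Set.eq_empty_iff_forall_notMem.1 h' y ⟨⟨y, hy, mem_univ _⟩, mem_univ _⟩

end DefinableGroup

end

end VeeAmenability

namespace VeeAmenability

noncomputable section

open DefinableGroup

variable {L : FirstOrder.Language.{u, v}} {T : L.Theory} {G : DefinableGroup.{u, v, w} T}
  {I : Type z} [Preorder I]

namespace VeeFamily

/-! ### Outer approximation by definable sets -/

section Outer

variable {N : Type w} [L.Structure N] {m : Set (G.Points N) → ℝ}

/-- The infimum of the values of `m` on definable sets containing `Y`. -/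
def outer (m : Set (G.Points N) → ℝ) (Y : Set (G.Points N)) : ℝ :=
  sInf (m '' {D | IsDefinable D ∧ Y ⊆ D})

lemma le_outer {Y : Set (G.Points N)} {a : ℝ}
    (h : ∀ D, IsDefinable D → Y ⊆ D → a ≤ m D) : a ≤ outer m Y :=
  le_csInf ⟨_, Set.univ, ⟨IsDefinableOver.univ, subset_univ Y⟩, rfl⟩
    (by rintro _ ⟨D, hD, rfl⟩; exact h D hD.1 hD.2)

lemma exists_lt_of_outer_lt {Y : Set (G.Points N)} {a : ℝ} (h : outer m Y < a) :
    ∃ D, IsDefinable D ∧ Y ⊆ D ∧ m D < a := by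
  by_contra! h'
  exact absurd (le_outer h') (not_le.2 h)

end Outer

variable (E : VeeFamily G I) {κ : Cardinal.{w}} {N : Type w} [L.Structure N]
  [N ⊨ T] [Nonempty N]

/-! ### Intersections of translates of `E_M` -/

/-- The relation `g₁ E_M ∩ ⋯ ∩ gₙ E_M`. -/
def interRel (M : Set N) {n : ℕ} (g : Fin n → G.Points N) : SetRel (G.Points N) (G.Points N) :=
  ⋂ k, g k • E.rel M

variable {E}

lemma mem_smul_rel {g x y : G.Points N} {R : SetRel (G.Points N) (G.Points N)} :
    (x, y) ∈ g • R ↔ (g⁻¹ * x, g⁻¹ * y) ∈ R :=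
  mem_smul_set_iff_inv_smul_mem

lemma mem_interRel {M : Set N} {n : ℕ} {g : Fin n → G.Points N} {x y : G.Points N} :
    (x, y) ∈ E.interRel M g ↔ ∀ k, ((g k)⁻¹ * x, (g k)⁻¹ * y) ∈ E.rel M := by
  simp only [interRel, mem_iInter, mem_smul_rel]

/-- Concatenating tuples intersects the relations, so two members of the lattice can be taken
saturated for one common relation. -/
lemma mem_interRel_append {M : Set N} {n n' : ℕ} {g : Fin n → G.Points N}
    {g' : Fin n' → G.Points N} {x y : G.Points N} :
    (x, y) ∈ E.interRel M (Fin.append g g') ↔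
      (x, y) ∈ E.interRel M g ∧ (x, y) ∈ E.interRel M g' := by
  simp only [mem_interRel, Fin.forall_fin_add, Fin.append_left, Fin.append_right]

lemma mem_interRel_mul {M : Set N} {n : ℕ} {g : Fin n → G.Points N} {h x y : G.Points N} :
    (x, y) ∈ E.interRel M (fun k => h * g k) ↔ (h⁻¹ * x, h⁻¹ * y) ∈ E.interRel M g := by
  simp only [mem_interRel, mul_inv_rev, mul_assoc]

lemma interRel_one (M : Set N) : E.interRel M (fun _ : Fin 1 => 1) = E.rel M := by
  ext ⟨x, y⟩
  simp [mem_interRel]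

lemma equivalence_interRel (hE : E.DefinesEquivalence) (M : L.ElementarySubstructure N) {n : ℕ}
    (g : Fin n → G.Points N) : Equivalence fun x y => (x, y) ∈ E.interRel (M : Set N) g where
  refl _ := mem_interRel.2 fun _ => (hE N M).refl _
  symm h := mem_interRel.2 fun k => (hE N M).symm (mem_interRel.1 h k)
  trans h h' := mem_interRel.2 fun k =>
    (hE N M).trans (mem_interRel.1 h k) (mem_interRel.1 h' k)

section Saturation

variable {M : L.ElementarySubstructure N} {n n' : ℕ} {g : Fin n → G.Points N}
  {g' : Fin n' → G.Points N} {Y Z : Set (G.Points N)}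

lemma subset_image_interRel (hE : E.DefinesEquivalence) :
    Y ⊆ SetRel.image (E.interRel (M : Set N) g) Y := fun x hx =>
  ⟨x, hx, (equivalence_interRel hE M g).refl x⟩

lemma image_image_interRel (hE : E.DefinesEquivalence) :
    SetRel.image (E.interRel (M : Set N) g) (SetRel.image (E.interRel (M : Set N) g) Y) =
      SetRel.image (E.interRel (M : Set N) g) Y := by
  refine Subset.antisymm ?_ (subset_image_interRel hE)
  rintro x ⟨y, ⟨t, ht, hty⟩, hyx⟩
  exact ⟨t, ht, (equivalence_interRel hE M g).trans hty hyx⟩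

lemma image_append_subset_left : SetRel.image (E.interRel (M : Set N) (Fin.append g g')) Y ⊆
    SetRel.image (E.interRel (M : Set N) g) Y := fun _ ⟨y, hy, hyx⟩ =>
  ⟨y, hy, (mem_interRel_append.1 hyx).1⟩

lemma image_append_subset_right : SetRel.image (E.interRel (M : Set N) (Fin.append g g')) Y ⊆
    SetRel.image (E.interRel (M : Set N) g') Y := fun _ ⟨y, hy, hyx⟩ =>
  ⟨y, hy, (mem_interRel_append.1 hyx).2⟩

lemma image_append_eq_left (hE : E.DefinesEquivalence)
    (hY : SetRel.image (E.interRel (M : Set N) g) Y = Y) :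
    SetRel.image (E.interRel (M : Set N) (Fin.append g g')) Y = Y :=
  Subset.antisymm (image_append_subset_left.trans hY.subset) (subset_image_interRel hE)

lemma image_append_eq_right (hE : E.DefinesEquivalence)
    (hY : SetRel.image (E.interRel (M : Set N) g') Y = Y) :
    SetRel.image (E.interRel (M : Set N) (Fin.append g g')) Y = Y :=
  Subset.antisymm (image_append_subset_right.trans hY.subset) (subset_image_interRel hE)

lemma image_inter_eq (hE : E.DefinesEquivalence)
    (hY : SetRel.image (E.interRel (M : Set N) g) Y = Y)
    (hZ : SetRel.image (E.interRel (M : Set N) g) Z = Z) :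
    SetRel.image (E.interRel (M : Set N) g) (Y ∩ Z) = Y ∩ Z := by
  refine Subset.antisymm ?_ (subset_image_interRel hE)
  rintro x ⟨y, ⟨h1, h2⟩, hyx⟩
  exact ⟨hY ▸ ⟨y, h1, hyx⟩, hZ ▸ ⟨y, h2, hyx⟩⟩

lemma image_interRel_inter_image_eq_empty (hE : E.DefinesEquivalence)
    (h : SetRel.image (E.interRel (M : Set N) g) Y ∩ Z = ∅) :
    SetRel.image (E.interRel (M : Set N) g) Y ∩ SetRel.image (E.interRel (M : Set N) g) Z = ∅ := by
  rw [Set.eq_empty_iff_forall_notMem] at h ⊢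
  rintro x ⟨⟨y, hy, hyx⟩, t, ht, htx⟩
  have e := equivalence_interRel hE M g
  exact h t ⟨⟨y, hy, e.trans hyx (e.symm htx)⟩, ht⟩

/-- Translation by `h` only permutes the family of all saturations; invariance of the infimum over
saturations rests on this. -/
lemma image_interRel_mul {h : G.Points N} :
    SetRel.image (E.interRel (M : Set N) fun k => h * g k) (h • Y) =
      h • SetRel.image (E.interRel (M : Set N) g) Y := by
  ext x
  rw [mem_smul_set_iff_inv_smul_mem]
  constructor
  · rintro ⟨y, hy, hyx⟩
    exact ⟨h⁻¹ * y, mem_smul_set_iff_inv_smul_mem.1 hy, mem_interRel_mul.1 hyx⟩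
  · rintro ⟨y, hy, hyx⟩
    refine ⟨h * y, smul_mem_smul_set hy, mem_interRel_mul.2 ?_⟩
    rwa [inv_mul_cancel_left]

end Saturation

/-! ### Neighbourhoods of `g₁ E_M ∩ ⋯ ∩ gₙ E_M` -/

lemma isDefinableRelOver_smul_inst {A : Set N} {i : I} {g : G.Points N}
    {b : Fin (E.arity i) → N} (hg : g ∈ pointsIn A) (hb : ∀ l, b l ∈ A) :
    IsDefinableRelOver A (g • E.inst i b) := by
  refine .of_isFirstOrder (P := fun N _ v => ∃ x y : Fin G.dim → N, G.dom.Realize x ∧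
    G.dom.Realize y ∧
    (E.form i).Realize (Sum.elim x (Sum.elim y fun l => v (Sum.inl ⟨b l, hb l⟩))) ∧
    G.mulGraph.Realize (Sum.elim (fun k => v (Sum.inl ⟨g.1 k, hg k⟩))
      (Sum.elim x (v ∘ Sum.inr ∘ Sum.inl))) ∧
    G.mulGraph.Realize (Sum.elim (fun k => v (Sum.inl ⟨g.1 k, hg k⟩))
      (Sum.elim y (v ∘ Sum.inr ∘ Sum.inr)))) ?_ fun x y => ?_
  · refine .exists_tuple (.exists_tuple (.and ?_ (.and ?_ (.and ?_ (.and ?_ ?_)))))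
    · exact .formula _ _ (Sum.inl ∘ Sum.inr) fun _ _ _ => rfl
    · exact .formula _ _ Sum.inr fun _ _ _ => rfl
    · exact .formula _ _ (Sum.elim (Sum.inl ∘ Sum.inr) (Sum.elim Sum.inr
        fun l => Sum.inl (Sum.inl (Sum.inl ⟨b l, hb l⟩)))) (by rintro _ _ (_ | _ | _) <;> rfl)
    · exact .formula _ _ (Sum.elim (fun k => Sum.inl (Sum.inl (Sum.inl ⟨g.1 k, hg k⟩)))
        (Sum.elim (Sum.inl ∘ Sum.inr) (Sum.inl ∘ Sum.inl ∘ Sum.inr ∘ Sum.inl)))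
        (by rintro _ _ (_ | _ | _) <;> rfl)
    · exact .formula _ _ (Sum.elim (fun k => Sum.inl (Sum.inl (Sum.inl ⟨g.1 k, hg k⟩)))
        (Sum.elim Sum.inr (Sum.inl ∘ Sum.inl ∘ Sum.inr ∘ Sum.inr)))
        (by rintro _ _ (_ | _ | _) <;> rfl)
  · rw [mem_smul_rel_iff_exists]
    refine exists_congr fun x' => exists_congr fun y' => ⟨?_, ?_⟩
    · rintro ⟨h1, h2, h⟩
      exact ⟨h1, h2, h⟩
    · rintro ⟨h1, h2, h⟩
      exact ⟨h1, h2, h⟩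

/-- The refinement axiom is applied to `M` itself, which places the new parameters in `M`; the
inclusion then passes up to `N` by elementarity. -/
lemma exists_inst_subset_inst {M : L.ElementarySubstructure N} {i j : I} (hij : i ≤ j)
    {b : Fin (E.arity i) → N} (hb : ∀ l, b l ∈ (M : Set N)) :
    ∃ c : Fin (E.arity j) → N, (∀ l, c l ∈ (M : Set N)) ∧ E.inst j c ⊆ E.inst i b := by
  obtain ⟨c, hc⟩ := E.refine_of_le M i j hij fun l => ⟨b l, hb l⟩
  have h : IsFirstOrder (L := L) fun (N : Type w) _ (v : Fin (E.arity i) ⊕ Fin (E.arity j) → N) =>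
      ∀ x y : Fin G.dim → N,
        (E.form j).Realize (Sum.elim x (Sum.elim y (v ∘ Sum.inr))) →
        (E.form i).Realize (Sum.elim x (Sum.elim y (v ∘ Sum.inl))) := by
    refine .forall_tuple (.forall_tuple (.imp ?_ ?_))
    · exact .formula _ _ (Sum.elim (Sum.inl ∘ Sum.inr) (Sum.elim Sum.inr
        (Sum.inl ∘ Sum.inl ∘ Sum.inr))) (by rintro _ _ (_ | _ | _) <;> rfl)
    · exact .formula _ _ (Sum.elim (Sum.inl ∘ Sum.inr) (Sum.elim Sum.inr
        (Sum.inl ∘ Sum.inl ∘ Sum.inl))) (by rintro _ _ (_ | _ | _) <;> rfl)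
  have h' := (h.elementarySubstructure M (Sum.elim (fun l => ⟨b l, hb l⟩) c)).1 hc
  exact ⟨fun l => c l, fun l => (c l).2, fun p hp => h' p.1.1 p.2.1 hp⟩

variable (E) in
/-- The finite intersections of translates by the elements `g k` of instances over `M` of one of
the formulas. -/
def nhdsRel (M : Set N) {n : ℕ} (g : Fin n → G.Points N) :
    Set (SetRel (G.Points N) (G.Points N)) :=
  {R | ∃ (i : I) (n' : ℕ) (g' : Fin n' → G.Points N) (b : Fin n' → Fin (E.arity i) → N),
    (∀ k, g' k ∈ Set.range g) ∧ (∀ k l, b k l ∈ M) ∧ R = ⋂ k, g' k • E.inst i (b k)}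

section NhdsRel

variable {M : L.ElementarySubstructure N} {n : ℕ} {g : Fin n → G.Points N}

lemma interRel_subset_of_mem_nhdsRel {R : SetRel (G.Points N) (G.Points N)}
    (hR : R ∈ E.nhdsRel (M : Set N) g) : E.interRel (M : Set N) g ⊆ R := by
  obtain ⟨i, n', g', b, hg', hb, rfl⟩ := hR
  rintro ⟨x, y⟩ h
  refine mem_iInter.2 fun k => mem_smul_rel.2 ?_
  obtain ⟨l, hl⟩ := hg' k
  exact hl ▸ mem_interRel.1 h l i (b k) (hb k)

lemma nhdsRel_nonempty [Nonempty I] : (E.nhdsRel (M : Set N) g).Nonempty :=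
  ⟨_, Classical.arbitrary I, 0, Fin.elim0, Fin.elim0, fun k => k.elim0, fun k => k.elim0, rfl⟩

/-- Directedness of `I` allows one index for all translates: refine the instances of both relations
to a common `j`, then concatenate. -/
lemma directedOn_nhdsRel [IsDirectedOrder I] :
    DirectedOn (· ⊇ ·) (E.nhdsRel (M : Set N) g) := by
  rintro _ ⟨i₁, n₁, g₁, b₁, hg₁, hb₁, rfl⟩ _ ⟨i₂, n₂, g₂, b₂, hg₂, hb₂, rfl⟩
  obtain ⟨j, h1, h2⟩ := exists_ge_ge i₁ i₂
  choose c₁ hc₁ hc₁' using fun k => exists_inst_subset_inst (M := M) h1 (hb₁ k)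
  choose c₂ hc₂ hc₂' using fun k => exists_inst_subset_inst (M := M) h2 (hb₂ k)
  refine ⟨_, ⟨j, n₁ + n₂, Fin.append g₁ g₂, Fin.append c₁ c₂, ?_, ?_, rfl⟩, ?_, ?_⟩
  · simpa [Fin.forall_fin_add] using ⟨hg₁, hg₂⟩
  · simpa [Fin.forall_fin_add] using ⟨hc₁, hc₂⟩
  · refine fun p hp => mem_iInter.2 fun k => smul_set_mono (hc₁' k) ?_
    simpa using mem_iInter.1 hp (Fin.castAdd n₂ k)
  · refine fun p hp => mem_iInter.2 fun k => smul_set_mono (hc₂' k) ?_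
    simpa using mem_iInter.1 hp (Fin.natAdd n₁ k)

lemma sInter_nhdsRel [Nonempty I] :
    ⋂₀ E.nhdsRel (M : Set N) g = E.interRel (M : Set N) g := by
  refine Subset.antisymm ?_ (subset_sInter fun R => interRel_subset_of_mem_nhdsRel)
  · rintro ⟨x, y⟩ h
    refine mem_interRel.2 fun k i b hb => mem_smul_rel.1 ?_
    have h' := h _ ⟨i, 1, fun _ => g k, fun _ => b, fun _ => ⟨k, rfl⟩, fun _ => hb, rfl⟩
    exact mem_iInter.1 h' 0

lemma isDefinableRelOver_of_mem_nhdsRel {A : Set N} (hMA : (M : Set N) ⊆ A)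
    (hg : ∀ k, g k ∈ pointsIn A) {R : SetRel (G.Points N) (G.Points N)}
    (hR : R ∈ E.nhdsRel (M : Set N) g) : IsDefinableRelOver A R := by
  obtain ⟨i, n', g', b, hg', hb, rfl⟩ := hR
  refine .iInter fun k => isDefinableRelOver_smul_inst ?_ fun l => hMA (hb k l)
  obtain ⟨l, hl⟩ := hg' k
  exact hl ▸ hg l

variable [Nonempty I] [IsDirectedOrder I]

/-- Compactness turns separation by the type-definable relation into separation of definable
supersets by finitely many translated instances, which is the form in which a pre-mean is additive.
-/
lemma exists_separation (hN : IsSaturated L κ N) {A : Set N} (hA : #A < κ)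
    (hMA : (M : Set N) ⊆ A) (hg : ∀ k, g k ∈ pointsIn A) {Y Z : Set (G.Points N)}
    (hY : IsTypeDefinableOver A Y) (hZ : IsTypeDefinableOver A Z)
    (h : SetRel.image (E.interRel (M : Set N) g) Y ∩ Z = ∅) :
    ∃ R ∈ E.nhdsRel (M : Set N) g, ∃ D ∈ definableSupersets A Y, ∃ F ∈ definableSupersets A Z,
      SetRel.image R D ∩ F = ∅ := by
  refine exists_image_inter_eq_empty hN hA nhdsRel_nonempty (definableSupersets_nonempty A Y)
    (definableSupersets_nonempty A Z) directedOn_nhdsRel (directedOn_definableSupersets A Y)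
    (directedOn_definableSupersets A Z) (fun R => isDefinableRelOver_of_mem_nhdsRel hMA hg)
    (fun D hD => hD.1) (fun F hF => hF.1) ?_
  rwa [sInter_nhdsRel, hY.sInter_definableSupersets, hZ.sInter_definableSupersets]

lemma isTypeDefinableOver_image_interRel (hN : IsMonster L κ N) {A : Set N} (hA : #A < κ)
    (hMA : (M : Set N) ⊆ A) (hg : ∀ k, g k ∈ pointsIn A) {Y : Set (G.Points N)}
    (hY : IsTypeDefinableOver A Y) :
    IsTypeDefinableOver A (SetRel.image (E.interRel (M : Set N) g) Y) := by
  intro x hx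
  -- The coordinates of `x` are adjoined only to run compactness against `{x}`. The resulting `R`
  -- and `D` are still over `A`, so `R ∘ D` is an `A`-definable superset omitting `x`.
  obtain ⟨C, hC, hxC⟩ := exists_params_finite hN.aleph0_lt fun _ : Fin 1 => x
  have hAC : A ⊆ A ∪ C := subset_union_left
  have hsing : IsDefinableOver (A ∪ C) {x} := .singleton fun k => Or.inr (hxC 0 k)
  obtain ⟨R, hR, D, hD, F, hF, h⟩ := exists_image_inter_eq_empty hN.saturated
    (hN.mk_union_lt hA hC)
    (nhdsRel_nonempty (E := E) (M := M) (g := g)) (definableSupersets_nonempty A Y)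
    (singleton_nonempty {x}) directedOn_nhdsRel (directedOn_definableSupersets A Y)
    (directedOn_singleton _)
    (fun R => isDefinableRelOver_of_mem_nhdsRel (hMA.trans hAC) fun k l => hAC (hg k l))
    (fun D hD => hD.1.mono hAC) (fun F hF => (mem_singleton_iff.1 hF) ▸ hsing) (by
      rw [sInter_nhdsRel, hY.sInter_definableSupersets, sInter_singleton]
      exact Set.inter_singleton_eq_empty.2 hx)
  refine ⟨SetRel.image R D, .image (isDefinableRelOver_of_mem_nhdsRel hMA hg hR) hD.1, ?_, ?_⟩
  · rintro z ⟨y, hy, hyz⟩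
    exact ⟨y, hD.2 hy, interRel_subset_of_mem_nhdsRel hR hyz⟩
  · rw [mem_singleton_iff] at hF
    subst hF
    exact Set.inter_singleton_eq_empty.1 h

end NhdsRel

/-! ### From pre-means to means -/

section LatticeMean

variable {M : L.ElementarySubstructure N} {m : Set (G.Points N) → ℝ}

lemma IsGPreMean.outer_le {M : Set N} (hm : E.IsGPreMean M m) {Y D : Set (G.Points N)}
    (hD : IsDefinable D) (hY : Y ⊆ D) : outer m Y ≤ m D :=
  csInf_le ⟨0, by rintro _ ⟨D, hD, rfl⟩; exact (hm.mem_Icc D hD.1).1⟩ ⟨D, ⟨hD, hY⟩, rfl⟩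

lemma IsGPreMean.outer_union_le {M : Set N} (hm : E.IsGPreMean M m) (Y Z : Set (G.Points N)) :
    outer m (Y ∪ Z) ≤ outer m Y + outer m Z := by
  rw [← sub_le_iff_le_add]
  refine le_outer fun D hD hY => ?_
  rw [sub_le_comm]
  refine le_outer fun F hF hZ => ?_
  rw [sub_le_iff_le_add']
  exact (hm.outer_le (hD.union hF) (union_subset_union hY hZ)).trans (hm.union_le D F hD hF)

variable [Nonempty I] [IsDirectedOrder I]

/-- Any definable `C` containing `Y ∪ Z` is cut by separated definable neighbourhoods of `Y` and
`Z`; the two pieces remain separated, so `m` is additive on them. -/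
lemma IsGPreMean.outer_add_outer_le (hm : E.IsGPreMean (M : Set N) m) (hN : IsSaturated L κ N)
    {A : Set N} (hA : #A < κ) (hMA : (M : Set N) ⊆ A) {n : ℕ} {g : Fin n → G.Points N}
    (hg : ∀ k, g k ∈ pointsIn A) {Y Z : Set (G.Points N)}
    (hY : IsTypeDefinableOver A Y) (hZ : IsTypeDefinableOver A Z)
    (h : SetRel.image (E.interRel (M : Set N) g) Y ∩ Z = ∅) :
    outer m Y + outer m Z ≤ outer m (Y ∪ Z) := by
  obtain ⟨_, ⟨i, n', g', b, -, hb, rfl⟩, D, hD, F, hF, hDF⟩ :=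
    exists_separation hN hA hMA hg hY hZ h
  refine le_outer fun C hC hYZ => ?_
  have h1 : IsDefinable (C ∩ D) := hC.inter hD.1.isDefinable
  have h2 : IsDefinable (C ∩ F) := hC.inter hF.1.isDefinable
  calc outer m Y + outer m Z
      ≤ m (C ∩ D) + m (C ∩ F) := add_le_add
        (hm.outer_le h1 (subset_inter (subset_union_left.trans hYZ) hD.2))
        (hm.outer_le h2 (subset_inter (subset_union_right.trans hYZ) hF.2))
    _ = m (C ∩ D ∪ C ∩ F) := by
        refine (hm.union_eq _ _ h1 h2 i n' g' b hb ?_).symm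
        rw [← subset_empty_iff, ← hDF]
        exact inter_subset_inter (SetRel.image_mono inter_subset_right) inter_subset_right
    _ ≤ m C := hm.monotone _ _ (h1.union h2) hC (union_subset inter_subset_left inter_subset_left)

/-- Modularity follows from subadditivity, superadditivity on disjoint saturated sets, and a
substitute `C` inside the lattice for the difference of two members, as provided by `hdiff`. -/
theorem IsGPreMean.isNormalizedMean_outer (hE : E.DefinesEquivalence) (hN : IsMonster L κ N)
    (hM : #M < κ) (hm : E.IsGPreMean (M : Set N) m) :
    IsNormalizedMean (E.lattice κ (M : Set N)) (outer m) := by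
  have hmono : ∀ Y Z : Set (G.Points N), Y ⊆ Z → outer m Y ≤ outer m Z := fun Y Z hYZ =>
    le_outer fun D hD hZ => hm.outer_le hD (hYZ.trans hZ)
  have hempty : outer m ∅ = 0 := le_antisymm
    ((hm.outer_le IsDefinableOver.empty Subset.rfl).trans hm.empty.le)
    (le_outer fun D hD _ => (hm.mem_Icc D hD).1)
  have huniv : outer m Set.univ = 1 := le_antisymm
    ((hm.outer_le IsDefinableOver.univ Subset.rfl).trans hm.univ.le)
    (le_outer fun D hD h => by rw [univ_subset_iff.1 h, hm.univ])
  refine ⟨fun Y _ => ⟨?_, ?_⟩, hempty, huniv, fun Y _ Z _ => hmono Y Z, ?_⟩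
  · exact hempty.symm.le.trans (hmono _ _ (empty_subset Y))
  · exact (hmono _ _ (subset_univ Y)).trans huniv.le
  rintro Y ⟨hY, n₁, g₁, hYs⟩ Z ⟨hZ, n₂, g₂, hZs⟩
  obtain ⟨A₁, hA₁, hY⟩ := isTypeDefinable_iff.1 hY
  obtain ⟨A₂, hA₂, hZ⟩ := isTypeDefinable_iff.1 hZ
  obtain ⟨A₃, hA₃, hg⟩ := exists_params_finite hN.aleph0_lt (Fin.append g₁ g₂)
  replace hYs : SetRel.image (E.interRel (M : Set N) (Fin.append g₁ g₂)) Y = Y :=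
    image_append_eq_left hE hYs
  replace hZs : SetRel.image (E.interRel (M : Set N) (Fin.append g₁ g₂)) Z = Z :=
    image_append_eq_right hE hZs
  -- From here a single relation saturates `Y` and `Z`, and all auxiliary sets stay saturated for
  -- it.
  generalize Fin.append g₁ g₂ = g at hg hYs hZs
  let Lat : Set (Set (G.Points N)) := {K | (∃ A : Set N, #A < κ ∧ IsTypeDefinableOver A K) ∧
    SetRel.image (E.interRel (M : Set N) g) K = K}
  have hLY : Y ∈ Lat := ⟨⟨A₁, hA₁, hY⟩, hYs⟩
  have hLZ : Z ∈ Lat := ⟨⟨A₂, hA₂, hZ⟩, hZs⟩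
  have hadd : ∀ K ∈ Lat, ∀ K' ∈ Lat, K ∩ K' = ∅ →
      outer m K + outer m K' ≤ outer m (K ∪ K') := by
    rintro K ⟨⟨B, hB, hK⟩, hKs⟩ K' ⟨⟨B', hB', hK'⟩, -⟩ h
    refine hm.outer_add_outer_le hN.saturated (A := (M ∪ A₃) ∪ (B ∪ B'))
      (hN.mk_union_lt (hN.mk_union_lt hM hA₃) (hN.mk_union_lt hB hB'))
      (subset_union_left.trans subset_union_left) (g := g)
      (fun k l => Or.inl (Or.inr (hg k l)))
      (hK.mono (subset_union_left.trans subset_union_right))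
      (hK'.mono (subset_union_right.trans subset_union_right)) ?_
    rwa [hKs]
  have hdiff : ∀ K ∈ Lat, ∀ K' ∈ Lat, ∀ D, IsDefinable D → K ⊆ D → ∃ C ∈ Lat, C ⊆ K' \ K ∧
      outer m K' ≤ m D + outer m C := by
    rintro K ⟨-, hKs⟩ K' ⟨⟨B, hB, hK'⟩, hKs'⟩ D hD hKD
    obtain ⟨B', hB', hD'⟩ := exists_finite_isDefinableOver hD
    have hB'κ : #B' < κ := hB'.lt_aleph0.trans hN.aleph0_lt
    have h1 : IsTypeDefinableOver ((M ∪ A₃) ∪ B')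
        (SetRel.image (E.interRel (M : Set N) g) Dᶜ) :=
      isTypeDefinableOver_image_interRel hN (hN.mk_union_lt (hN.mk_union_lt hM hA₃) hB'κ)
        (subset_union_left.trans subset_union_left) (fun k l => Or.inl (Or.inr (hg k l)))
        (hD'.compl.mono subset_union_right).isTypeDefinableOver
    -- `K' \ D` need not be saturated, so it is replaced by its saturation inside `K'`. This still
    -- misses `K`, because `K` is saturated and contained in `D`.
    refine ⟨K' ∩ SetRel.image (E.interRel (M : Set N) g) Dᶜ, ⟨⟨B ∪ ((M ∪ A₃) ∪ B'),
      hN.mk_union_lt hB (hN.mk_union_lt (hN.mk_union_lt hM hA₃) hB'κ),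
      (hK'.mono subset_union_left).inter (h1.mono subset_union_right)⟩,
      image_inter_eq hE hKs' (image_image_interRel hE)⟩, ?_, ?_⟩
    · rintro x ⟨hx, y, hy, hyx⟩
      refine ⟨hx, fun hxK => hy (hKD ?_)⟩
      rw [← hKs]
      exact ⟨x, hxK, (equivalence_interRel hE M g).symm hyx⟩
    · have h2 : K' ⊆ D ∪ (K' ∩ SetRel.image (E.interRel (M : Set N) g) Dᶜ) := by
        intro x hx
        by_cases hxD : x ∈ D
        · exact Or.inl hxD
        · exact Or.inr ⟨hx, subset_image_interRel hE hxD⟩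
      exact (hmono _ _ h2).trans ((hm.outer_union_le _ _).trans
        (add_le_add_left (hm.outer_le hD Subset.rfl) _))
  have hLU : Y ∪ Z ∈ Lat := by
    refine ⟨⟨A₁ ∪ A₂, hN.mk_union_lt hA₁ hA₂, (hY.mono subset_union_left).union
      (hZ.mono subset_union_right)⟩, ?_⟩
    rw [SetRel.image_union, hYs, hZs]
  have hLI : Y ∩ Z ∈ Lat :=
    ⟨⟨A₁ ∪ A₂, hN.mk_union_lt hA₁ hA₂, (hY.mono subset_union_left).inter
      (hZ.mono subset_union_right)⟩, image_inter_eq hE hYs hZs⟩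
  refine le_antisymm ?_ ?_
  -- Up to `ε`, `Y ∪ Z` is covered by `Z` and a set `C` in `Y` that is disjoint from `Y ∩ Z`;
  -- superadditivity inside `Y` bounds `C`.
  · refine le_of_forall_pos_le_add fun ε hε => ?_
    obtain ⟨D, hD, hZD, hlt⟩ := exists_lt_of_outer_lt (lt_add_of_pos_right (outer m Z) hε)
    obtain ⟨C, hC, hCs, hle⟩ := hdiff Z hLZ (Y ∪ Z) hLU D hD hZD
    have h1 : C ⊆ Y := fun x hx => (hCs hx).1.resolve_right (hCs hx).2
    have h2 : C ∩ (Y ∩ Z) = ∅ := Set.eq_empty_iff_forall_notMem.2 fun x hx =>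
      (hCs hx.1).2 hx.2.2
    have h3 := (hadd C hC _ hLI h2).trans (hmono _ _ (union_subset h1 inter_subset_left))
    linarith
  -- Up to `ε`, `Y` is covered by `Y ∩ Z` and a set `C` in `Y` that is disjoint from `Z`;
  -- superadditivity inside `Y ∪ Z` bounds `C`.
  · refine le_of_forall_pos_le_add fun ε hε => ?_
    obtain ⟨D, hD, hZD, hlt⟩ := exists_lt_of_outer_lt (lt_add_of_pos_right (outer m (Y ∩ Z)) hε)
    obtain ⟨C, hC, hCs, hle⟩ := hdiff (Y ∩ Z) hLI Y hLY D hD hZD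
    have h2 : C ∩ Z = ∅ := Set.eq_empty_iff_forall_notMem.2 fun x hx =>
      (hCs hx.1).2 ⟨(hCs hx.1).1, hx.2⟩
    have h3 := (hadd C hC Z hLZ h2).trans
      (hmono _ _ (union_subset_union_left Z (hCs.trans sdiff_subset)))
    linarith

theorem HasInvariantGPreMean.hasInvariantMean (hE : E.DefinesEquivalence) (hN : IsMonster L κ N)
    (hM : #M < κ) (h : E.HasInvariantGPreMean (M : Set N) Set.univ) :
    HasInvariantMean (E.lattice κ (M : Set N)) Set.univ := by
  obtain ⟨m, hm, hinv⟩ := h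
  have hle : ∀ (g : G.Points N) Y, outer m (g • Y) ≤ outer m Y := fun g Y =>
    le_outer fun D hD hY =>
      hinv g (mem_univ g) D hD ▸ hm.outer_le (hD.smul g) (smul_set_mono hY)
  refine ⟨outer m, hm.isNormalizedMean_outer hE hN hM, fun g _ Y _ => le_antisymm (hle g Y) ?_⟩
  simpa using hle g⁻¹ (g • Y)

end LatticeMean

/-! ### From means to pre-means -/

section PreMean

variable {M : L.ElementarySubstructure N} {ρ : Set (G.Points N) → ℝ}
  [Nonempty I] [IsDirectedOrder I]

variable (E) in
/-- The infimum of the values of `ρ` on the saturations of `Y` under the relations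
`g₁ E_M ∩ ⋯ ∩ gₙ E_M`. -/
def saturationInf (M : Set N) (ρ : Set (G.Points N) → ℝ) (Y : Set (G.Points N)) : ℝ :=
  ⨅ p : Σ n : ℕ, Fin n → G.Points N, ρ (SetRel.image (E.interRel M p.2) Y)

lemma image_interRel_mem_lattice (hE : E.DefinesEquivalence) (hN : IsMonster L κ N) (hM : #M < κ)
    {Y : Set (G.Points N)} (hY : IsDefinable Y) {n : ℕ} (g : Fin n → G.Points N) :
    SetRel.image (E.interRel (M : Set N) g) Y ∈ E.lattice κ (M : Set N) := by
  obtain ⟨A, hA, hY⟩ := exists_finite_isDefinableOver hY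
  obtain ⟨B, hB, hg⟩ := exists_params_finite hN.aleph0_lt g
  have hκ : #((M ∪ A) ∪ B : Set N) < κ :=
    hN.mk_union_lt (hN.mk_union_lt hM (hA.lt_aleph0.trans hN.aleph0_lt)) hB
  refine ⟨isTypeDefinable_iff.2 ⟨_, hκ, isTypeDefinableOver_image_interRel hN hκ
    (subset_union_left.trans subset_union_left) (fun k l => Or.inr (hg k l))
    (hY.mono (subset_union_right.trans subset_union_left)).isTypeDefinableOver⟩, n, g,
    image_image_interRel hE⟩

/-- The saturations of a definable set lie in the lattice and shrink as tuples are concatenated, so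
inequalities can be checked on a common tuple. Sets separated by translated instances have disjoint
saturations once the tuple contains the translating elements, and there `ρ` is additive. -/
lemma _root_.VeeAmenability.HasInvariantMean.hasInvariantGPreMean (hE : E.DefinesEquivalence)
    (hN : IsMonster L κ N) (hM : #M < κ) (h : HasInvariantMean (E.lattice κ (M : Set N)) Set.univ) :
    E.HasInvariantGPreMean (M : Set N) Set.univ := by
  obtain ⟨ρ, hρ, hinv⟩ := h
  have hmem : ∀ {Y : Set (G.Points N)}, IsDefinable Y → ∀ {n : ℕ} (g : Fin n → G.Points N),
      SetRel.image (E.interRel (M : Set N) g) Y ∈ E.lattice κ (M : Set N) := fun hY _ g =>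
    image_interRel_mem_lattice hE hN hM hY g
  have : Nonempty (Σ n : ℕ, Fin n → G.Points N) := ⟨⟨0, Fin.elim0⟩⟩
  have hle : ∀ {Y : Set (G.Points N)}, IsDefinable Y → ∀ {n : ℕ} (g : Fin n → G.Points N),
      E.saturationInf (M : Set N) ρ Y ≤ ρ (SetRel.image (E.interRel (M : Set N) g) Y) :=
    fun hY n g => ciInf_le (f := fun p : Σ n : ℕ, Fin n → G.Points N =>
      ρ (SetRel.image (E.interRel (M : Set N) p.2) _))
      ⟨0, by rintro _ ⟨p, rfl⟩; exact (hρ.mem_Icc _ (hmem hY p.2)).1⟩ ⟨n, g⟩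
  have hge : ∀ {Y : Set (G.Points N)} {a : ℝ}, (∀ (n : ℕ) (g : Fin n → G.Points N),
      a ≤ ρ (SetRel.image (E.interRel (M : Set N) g) Y)) → a ≤ E.saturationInf (M : Set N) ρ Y :=
    fun h => le_ciInf fun p => h p.1 p.2
  have hdisj : ∀ {Y Z : Set (G.Points N)}, Y ∈ E.lattice κ (M : Set N) →
      Z ∈ E.lattice κ (M : Set N) → Y ∩ Z = ∅ → ρ (Y ∪ Z) = ρ Y + ρ Z := fun hY hZ h => by
    rw [hρ.modular _ hY _ hZ, h, hρ.empty, sub_zero]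
  have hsub : ∀ {Y Z : Set (G.Points N)}, Y ∈ E.lattice κ (M : Set N) →
      Z ∈ E.lattice κ (M : Set N) → Y ∩ Z ∈ E.lattice κ (M : Set N) →
      ρ (Y ∪ Z) ≤ ρ Y + ρ Z := fun hY hZ h => by
    rw [hρ.modular _ hY _ hZ]
    linarith [(hρ.mem_Icc _ h).1]
  have hinter : ∀ {Y Z : Set (G.Points N)}, IsDefinable Y → IsDefinable Z → ∀ {n : ℕ}
      (g : Fin n → G.Points N), SetRel.image (E.interRel (M : Set N) g) Y ∩
        SetRel.image (E.interRel (M : Set N) g) Z ∈ E.lattice κ (M : Set N) := by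
    intro Y Z hY hZ n g
    obtain ⟨A, hA, h1⟩ := isTypeDefinable_iff.1 (hmem hY g).1
    obtain ⟨B, hB, h2⟩ := isTypeDefinable_iff.1 (hmem hZ g).1
    exact ⟨isTypeDefinable_iff.2 ⟨A ∪ B, hN.mk_union_lt hA hB, (h1.mono subset_union_left).inter
      (h2.mono subset_union_right)⟩, n, g,
      image_inter_eq hE (image_image_interRel hE) (image_image_interRel hE)⟩
  have hmonoρ : ∀ {Y Z : Set (G.Points N)}, IsDefinable Y → IsDefinable Z → Y ⊆ Z →
      ∀ {n n' : ℕ} {g : Fin n → G.Points N} {g' : Fin n' → G.Points N},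
      (∀ x y, (x, y) ∈ E.interRel (M : Set N) g → (x, y) ∈ E.interRel (M : Set N) g') →
      ρ (SetRel.image (E.interRel (M : Set N) g) Y) ≤
        ρ (SetRel.image (E.interRel (M : Set N) g') Z) := by
    intro Y Z hY hZ hYZ n n' g g' hgg'
    refine hρ.monotone _ (hmem hY g) _ (hmem hZ g') ?_
    rintro x ⟨y, hy, hyx⟩
    exact ⟨y, hYZ hy, hgg' _ _ hyx⟩
  have hunion : ∀ {Y Z : Set (G.Points N)}, IsDefinable Y → IsDefinable Z →
      E.saturationInf (M : Set N) ρ (Y ∪ Z) ≤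
        E.saturationInf (M : Set N) ρ Y + E.saturationInf (M : Set N) ρ Z := by
    intro Y Z hY hZ
    rw [← sub_le_iff_le_add]
    refine hge fun n g => ?_
    rw [sub_le_comm]
    refine hge fun n' g' => ?_
    rw [sub_le_iff_le_add']
    refine (hle (hY.union hZ) (Fin.append g g')).trans ?_
    rw [SetRel.image_union]
    exact (hsub (hmem hY _) (hmem hZ _) (hinter hY hZ _)).trans (add_le_add
      (hmonoρ hY hY Subset.rfl fun _ _ h => (mem_interRel_append.1 h).1)
      (hmonoρ hZ hZ Subset.rfl fun _ _ h => (mem_interRel_append.1 h).2))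
  refine ⟨E.saturationInf (M : Set N) ρ, ⟨?_, ?_, ?_, ?_, ?_, ?_⟩, ?_⟩
  · exact fun Y hY => ⟨hge fun n g => (hρ.mem_Icc _ (hmem hY g)).1,
      (hle hY Fin.elim0).trans (hρ.mem_Icc _ (hmem hY _)).2⟩
  · simp only [saturationInf, SetRel.image_empty_right, hρ.empty, ciInf_const]
  · have h : ∀ (n : ℕ) (g : Fin n → G.Points N),
        SetRel.image (E.interRel (M : Set N) g) Set.univ = Set.univ := fun n g =>
      univ_subset_iff.1 (subset_image_interRel hE)
    simp only [saturationInf, h, hρ.univ, ciInf_const]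
  · exact fun Y Z hY hZ hYZ => hge fun n g =>
      (hle hY g).trans (hmonoρ hY hZ hYZ fun _ _ h => h)
  · exact fun Y Z hY hZ => hunion hY hZ
  · intro Y Z hY hZ i n g b hb hYZ
    refine le_antisymm (hunion hY hZ) (hge fun n' g' => ?_)
    · have h1 : SetRel.image (E.interRel (M : Set N) (Fin.append g g')) Y ∩ Z = ∅ := by
        rw [← subset_empty_iff, ← hYZ]
        refine inter_subset_inter_left Z (image_append_subset_left.trans ?_)
        rintro x ⟨y, hy, hyx⟩
        exact ⟨y, hy, interRel_subset_of_mem_nhdsRel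
          ⟨i, n, g, b, fun k => ⟨k, rfl⟩, hb, rfl⟩ hyx⟩
      calc E.saturationInf (M : Set N) ρ Y + E.saturationInf (M : Set N) ρ Z
          ≤ ρ (SetRel.image (E.interRel (M : Set N) (Fin.append g g')) Y) +
            ρ (SetRel.image (E.interRel (M : Set N) (Fin.append g g')) Z) :=
            add_le_add (hle hY _) (hle hZ _)
        _ = ρ (SetRel.image (E.interRel (M : Set N) (Fin.append g g')) (Y ∪ Z)) := by
            rw [SetRel.image_union, hdisj (hmem hY _) (hmem hZ _)
              (image_interRel_inter_image_eq_empty hE h1)]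
        _ ≤ _ := hmonoρ (hY.union hZ) (hY.union hZ) Subset.rfl
            fun _ _ h => (mem_interRel_append.1 h).2
  · have hsm : ∀ (h : G.Points N) (Y : Set (G.Points N)), IsDefinable Y →
        E.saturationInf (M : Set N) ρ (h • Y) ≤ E.saturationInf (M : Set N) ρ Y := fun h Y hY =>
      hge fun n g => by
        refine (hle (hY.smul h) fun k => h * g k).trans ?_
        rw [image_interRel_mul, hinv h (mem_univ h) _ (hmem hY g)]
    intro h _ Y hY
    refine le_antisymm (hsm h Y hY) ?_
    simpa using hsm h⁻¹ (h • Y) (hY.smul h)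

end PreMean

end VeeFamily

end

end VeeAmenability

namespace VeeAmenability

noncomputable section

open DefinableGroup TopologicalSpace Topology

variable {L : FirstOrder.Language.{u, v}} {T : L.Theory} {G : DefinableGroup.{u, v, w} T}
  {I : Type z} [Preorder I] {κ : Cardinal.{w}} {N : Type w} [L.Structure N]

/-! ### Automorphisms over small sets -/

namespace DefinableGroup

/-- The hypothesis is only an implication, but definable sets are closed under complement, so `x`
and `y` have the same type over `M` and homogeneity applies. -/
lemma exists_autMap_eq (hN : IsMonster L κ N) {M : Set N} (hM : #M < κ) {x y : G.Points N}
    (h : ∀ D, IsDefinableOver M D → x ∈ D → y ∈ D) :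
    ∃ σ : N ≃[L] N, (∀ a ∈ M, σ a = a) ∧ autMap σ x = y := by
  have hψ : ∀ ψ : L.Formula (M ⊕ Fin G.dim), ψ.Realize (Sum.elim (fun a : M => (a : N)) x.1) →
      ψ.Realize (Sum.elim (fun a : M => (a : N)) y.1) := fun ψ hx =>
    h (fiber G ψ fun a : M => (a : N)) (isDefinableOver_fiber ψ fun a => a.2) hx
  have hA : ∀ a : (M ∪ Set.range x.1 : Set N), ∃ s : M ⊕ Fin G.dim,
      Sum.elim (fun a : M => (a : N)) x.1 s = a := by
    rintro ⟨a, ha | ⟨k, rfl⟩⟩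
    · exact ⟨Sum.inl ⟨a, ha⟩, rfl⟩
    · exact ⟨Sum.inr k, rfl⟩
  -- An element may have several names, as a point of `M` or as various coordinates of `x`. One is
  -- chosen, and `hterm` shows that its image does not depend on the name.
  choose s hs using hA
  have hterm : ∀ (a : (M ∪ Set.range x.1 : Set N)) (t : M ⊕ Fin G.dim),
      Sum.elim (fun a : M => (a : N)) x.1 t = a →
      Sum.elim (fun a : M => (a : N)) y.1 (s a) = Sum.elim (fun a : M => (a : N)) y.1 t :=
    fun a t ht => by
      have h1 := hψ (Term.equal (Term.var (s a)) (Term.var t))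
      simp only [Formula.realize_equal, Term.realize_var] at h1
      exact h1 ((hs a).trans ht.symm)
  obtain ⟨σ, hσ⟩ := hN.homogeneous (M ∪ Set.range x.1)
    (hN.mk_union_lt hM ((Set.finite_range _).lt_aleph0.trans hN.aleph0_lt))
    (fun a => Sum.elim (fun a : M => (a : N)) y.1 (s a)) (fun φ => by
      have e : (fun a : (M ∪ Set.range x.1 : Set N) => (a : N)) =
        Sum.elim (fun a : M => (a : N)) x.1 ∘ s := funext fun a => (hs a).symm
      have e' : (fun a => Sum.elim (fun a : M => (a : N)) y.1 (s a)) =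
        Sum.elim (fun a : M => (a : N)) y.1 ∘ s := rfl
      rw [e, e', ← Formula.realize_relabel, ← Formula.realize_relabel]
      refine ⟨hψ _, fun hy => ?_⟩
      by_contra hx
      exact (Formula.realize_not.1 (hψ (φ.relabel s).not (Formula.realize_not.2 hx))) hy)
  refine ⟨σ, fun a ha => ?_, Subtype.ext (funext fun k => ?_)⟩
  · exact (hσ ⟨a, Or.inl ha⟩).trans (hterm _ (Sum.inl ⟨a, ha⟩) rfl)
  · exact (hσ ⟨x.1 k, Or.inr ⟨k, rfl⟩⟩).trans (hterm _ (Sum.inr k) rfl)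

lemma IsTypeDefinableOver.autMap_mem {M : Set N} {Y : Set (G.Points N)}
    (hY : IsTypeDefinableOver M Y) {σ : N ≃[L] N} (hσ : ∀ a ∈ M, σ a = a) {y : G.Points N}
    (hy : y ∈ Y) : autMap σ y ∈ Y := by
  by_contra h
  obtain ⟨D, hD, hYD, hσD⟩ := hY _ h
  obtain ⟨φ, hφ⟩ := isDefinableOver_iff.1 hD
  refine hσD ((hφ _).2 ?_)
  have h1 := (StrongHomClass.realize_formula σ φ).2 ((hφ y).1 (hYD hy))
  have h2 : (σ ∘ fun a : M => (a : N)) = fun a : M => (a : N) := funext fun a => hσ a.1 a.2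
  rw [Sum.comp_elim, h2] at h1
  exact h1

/-- The `M`-definable sets are closed under finite intersections and complements, so they form a
basis of clopen sets. -/
lemma isClosed_generateFrom_iff {M : Set N} {Y : Set (G.Points N)} :
    IsClosed[generateFrom {D : Set (G.Points N) | IsDefinableOver M D}] Y ↔
      IsTypeDefinableOver M Y := by
  let := generateFrom {D : Set (G.Points N) | IsDefinableOver M D}
  rw [← isOpen_compl_iff]
  constructor
  · intro h
    have key : ∀ U : Set (G.Points N),
        GenerateOpen {D : Set (G.Points N) | IsDefinableOver M D} U →
        ∀ x ∈ U, ∃ D, IsDefinableOver M D ∧ D ⊆ U ∧ x ∈ D := by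
      intro U hU
      induction hU with
      | basic D hD => exact fun x hx => ⟨D, hD, Subset.rfl, hx⟩
      | univ => exact fun x hx => ⟨Set.univ, .univ, Subset.rfl, hx⟩
      | inter U V _ _ hU hV =>
        rintro x ⟨h1, h2⟩
        obtain ⟨D, hD, hDU, hx⟩ := hU x h1
        obtain ⟨F, hF, hFV, hx'⟩ := hV x h2
        exact ⟨D ∩ F, hD.inter hF, inter_subset_inter hDU hFV, hx, hx'⟩
      | sUnion S _ hS =>
        rintro x ⟨U, hU, hx⟩
        obtain ⟨D, hD, hDU, hx⟩ := hS U hU x hx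
        exact ⟨D, hD, subset_sUnion_of_subset S U hDU hU, hx⟩
    intro x hx
    obtain ⟨D, hD, hDY, hxD⟩ := key _ h x hx
    exact ⟨Dᶜ, hD.compl, subset_compl_comm.1 hDY, fun h => h hxD⟩
  · intro h
    rw [isOpen_iff_forall_mem_open]
    intro x hx
    obtain ⟨D, hD, hYD, hxD⟩ := h x hx
    exact ⟨Dᶜ, compl_subset_compl.2 hYD, isOpen_generateFrom_of_mem hD.compl, hxD⟩

end DefinableGroup

namespace VeeFamily

variable {E : VeeFamily G I} [N ⊨ T] [Nonempty N]

/-! ### The space of types of classes -/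

section Space

variable {hE : E.DefinesEquivalence} {M : L.ElementarySubstructure N}

variable (hE M) in
/-- The type of the class of an element of `G(N)`. -/
def toTypeSpace (x : G.Points N) : E.TypeSpace hE M := Quotient.mk (E.typeSetoid hE M) x

lemma toTypeSpace_surjective : Function.Surjective (toTypeSpace hE M) := Quotient.mk_surjective

lemma toTypeSpace_eq_iff {x y : G.Points N} :
    toTypeSpace hE M x = toTypeSpace hE M y ↔ E.SameType (M : Set N) x y := Quotient.eq

lemma toTypeSpace_eq_of_rel {x y : G.Points N} (h : (x, y) ∈ E.rel (M : Set N)) :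
    toTypeSpace hE M x = toTypeSpace hE M y :=
  toTypeSpace_eq_iff.2 ⟨Language.Equiv.refl L N, fun _ _ => rfl, h⟩

lemma isClosed_typeSpace_iff {K : Set (E.TypeSpace hE M)} :
    IsClosed K ↔ IsTypeDefinableOver (M : Set N) (toTypeSpace hE M ⁻¹' K) :=
  isClosed_coinduced.trans isClosed_generateFrom_iff

/-- Automorphisms over `M` preserve `Y`, so of the relation `SameType` only the `E_M` part can
enlarge it. -/
lemma preimage_image_toTypeSpace {Y : Set (G.Points N)}
    (hY : IsTypeDefinableOver (M : Set N) Y) :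
    toTypeSpace hE M ⁻¹' (toTypeSpace hE M '' Y) = SetRel.image (E.rel (M : Set N)) Y := by
  ext x
  constructor
  · rintro ⟨y, hy, h⟩
    obtain ⟨σ, hσ, h⟩ := toTypeSpace_eq_iff.1 h
    exact ⟨autMap σ y, hY.autMap_mem hσ hy, h⟩
  · rintro ⟨y, hy, h⟩
    exact ⟨y, hy, toTypeSpace_eq_of_rel h⟩

lemma image_rel_preimage (K : Set (E.TypeSpace hE M)) :
    SetRel.image (E.rel (M : Set N)) (toTypeSpace hE M ⁻¹' K) = toTypeSpace hE M ⁻¹' K := by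
  refine Subset.antisymm ?_ fun x hx => ⟨x, hx, (hE N M).refl x⟩
  rintro x ⟨y, hy, h⟩
  rwa [mem_preimage, ← toTypeSpace_eq_of_rel h]

lemma compactSpace_typeSpace (hN : IsMonster L κ N) (hM : #M < κ) :
    CompactSpace (E.TypeSpace hE M) := by
  classical
  refine compactSpace_of_finite_subfamily_closed fun {ι} K hK h => ?_
  by_contra! hcon
  obtain ⟨x, hx⟩ := exists_mem_sInter hN.saturated (A := (M : Set N)) hM
    (𝓨 := {D | IsDefinableOver (M : Set N) D ∧
      ∃ u : Finset ι, toTypeSpace hE M ⁻¹' (⋂ i ∈ u, K i) ⊆ D})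
    ⟨Set.univ, .univ, ∅, subset_univ _⟩
    (by
      rintro D ⟨hD, u, hu⟩ F ⟨hF, u', hu'⟩
      refine ⟨D ∩ F, ⟨hD.inter hF, u ∪ u', fun y hy => ⟨hu ?_, hu' ?_⟩⟩, inter_subset_left,
        inter_subset_right⟩
      · exact mem_iInter₂.2 fun i hi => mem_iInter₂.1 hy i (Finset.mem_union_left _ hi)
      · exact mem_iInter₂.2 fun i hi => mem_iInter₂.1 hy i (Finset.mem_union_right _ hi))
    (fun D hD => hD.1)
    (by
      rintro D ⟨-, u, hu⟩
      obtain ⟨p, hp⟩ := hcon u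
      obtain ⟨y, rfl⟩ := toTypeSpace_surjective p
      exact ⟨y, hu hp⟩)
  refine Set.eq_empty_iff_forall_notMem.1 h (toTypeSpace hE M x) (mem_iInter.2 fun i => ?_)
  by_contra hxi
  obtain ⟨D, hD, h1, h2⟩ := isClosed_typeSpace_iff.1 (hK i) x hxi
  exact h2 (hx D ⟨hD, {i}, by simpa using h1⟩)

lemma preimage_mem_lattice (hM : #M < κ) {K : Set (E.TypeSpace hE M)} (hK : IsClosed K) :
    toTypeSpace hE M ⁻¹' K ∈ E.lattice κ (M : Set N) := by
  refine ⟨isTypeDefinable_iff.2 ⟨M, hM, isClosed_typeSpace_iff.1 hK⟩, 1, fun _ => 1, ?_⟩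
  have h := image_rel_preimage K
  rwa [← interRel_one] at h

variable [Nonempty I] [IsDirectedOrder I]

lemma isClosed_image_toTypeSpace (hN : IsMonster L κ N) (hM : #M < κ) {Y : Set (G.Points N)}
    (hY : IsTypeDefinableOver (M : Set N) Y) : IsClosed (toTypeSpace hE M '' Y) := by
  rw [isClosed_typeSpace_iff, preimage_image_toTypeSpace hY, ← interRel_one]
  exact isTypeDefinableOver_image_interRel hN hM Subset.rfl (fun _ => one_mem_pointsIn M) hY

lemma t1Space_typeSpace (hN : IsMonster L κ N) (hM : #M < κ) : T1Space (E.TypeSpace hE M) := by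
  refine ⟨fun p => ?_⟩
  obtain ⟨x, rfl⟩ := toTypeSpace_surjective p
  -- This is the set of realizations of the type of `x` over `M`. By homogeneity they are all
  -- conjugate over `M`, so its closed image is a single point.
  have hx : IsTypeDefinableOver (M : Set N) (⋂₀ {D | IsDefinableOver (M : Set N) D ∧ x ∈ D}) := by
    intro y hy
    simp only [mem_sInter, not_forall] at hy
    obtain ⟨D, hD, hy⟩ := hy
    exact ⟨D, hD.1, sInter_subset_of_mem hD, hy⟩
  convert! isClosed_image_toTypeSpace (hE := hE) hN hM hx
  refine Subset.antisymm ?_ ?_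
  · rintro _ rfl
    exact ⟨x, fun D hD => hD.2, rfl⟩
  · rintro _ ⟨y, hy, rfl⟩
    obtain ⟨σ, hσ, h⟩ := exists_autMap_eq hN hM fun D hD hxD => hy D ⟨hD, hxD⟩
    exact (toTypeSpace_eq_iff.2 ⟨σ, hσ, h ▸ (hE N M).refl _⟩ :
      toTypeSpace hE M x = toTypeSpace hE M y).symm

lemma t2Space_typeSpace (hN : IsMonster L κ N) (hM : #M < κ) : T2Space (E.TypeSpace hE M) := by
  have := t1Space_typeSpace (hE := hE) hN hM
  refine ⟨fun p q hpq => ?_⟩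
  have hsep : SetRel.image (E.interRel (M : Set N) fun _ : Fin 1 => 1)
      (toTypeSpace hE M ⁻¹' {p}) ∩ toTypeSpace hE M ⁻¹' {q} = ∅ := by
    rw [interRel_one, image_rel_preimage, ← preimage_inter, Set.singleton_inter_eq_empty.2
      (by simpa using hpq), preimage_empty]
  obtain ⟨R, hR, D, hD, F, hF, h⟩ := exists_separation hN.saturated hM Subset.rfl
    (fun _ => one_mem_pointsIn M) (isClosed_typeSpace_iff.1 isClosed_singleton)
    (isClosed_typeSpace_iff.1 isClosed_singleton) hsep
  -- These are the points all of whose representatives lie in `D`, respectively in `F`. They are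
  -- disjoint because `R` is reflexive, which forces `D ∩ F` to be empty.
  refine ⟨(toTypeSpace hE M '' Dᶜ)ᶜ, (toTypeSpace hE M '' Fᶜ)ᶜ,
    (isClosed_image_toTypeSpace hN hM hD.1.compl.isTypeDefinableOver).isOpen_compl,
    (isClosed_image_toTypeSpace hN hM hF.1.compl.isTypeDefinableOver).isOpen_compl, ?_, ?_, ?_⟩
  · rintro ⟨x, hx, rfl⟩
    exact hx (hD.2 rfl)
  · rintro ⟨x, hx, rfl⟩
    exact hx (hF.2 rfl)
  · rw [Set.disjoint_left]
    intro r hr hr'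
    obtain ⟨x, rfl⟩ := toTypeSpace_surjective r
    have hxD : x ∈ D := by
      by_contra hx
      exact hr ⟨x, hx, rfl⟩
    have hxF : x ∈ F := by
      by_contra hx
      exact hr' ⟨x, hx, rfl⟩
    refine Set.eq_empty_iff_forall_notMem.1 h x ⟨⟨x, hxD, ?_⟩, hxF⟩
    exact interRel_subset_of_mem_nhdsRel hR ((equivalence_interRel hE M _).refl x)

end Space

/-! ### Invariant measures -/

section Measure

variable {hE : E.DefinesEquivalence} {M : L.ElementarySubstructure N}
  {hinv : E.IsInvariant (M : Set N)}

lemma preimage_translate_image {g : G.Points N} (hg : g ∈ pointsIn (M : Set N))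
    (Y : Set (G.Points N)) :
    translate hE M hinv g hg ⁻¹' (toTypeSpace hE M '' (g • Y)) = toTypeSpace hE M '' Y := by
  ext p
  obtain ⟨x, rfl⟩ := toTypeSpace_surjective p
  constructor
  · rintro ⟨_, ⟨y, hy, rfl⟩, h⟩
    refine ⟨y, hy, ?_⟩
    have h' : toTypeSpace hE M (g⁻¹ * (g * y)) = toTypeSpace hE M (g⁻¹ * (g * x)) :=
      congrArg (translate hE M hinv g⁻¹ (inv_mem_pointsIn hg)) h
    simpa only [inv_mul_cancel_left] using h'
  · rintro ⟨y, hy, h⟩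
    exact ⟨g * y, smul_mem_smul_set hy, congrArg (translate hE M hinv g hg) h⟩

lemma preimage_toTypeSpace_translate {g : G.Points N} (hg : g ∈ pointsIn (M : Set N))
    (K : Set (E.TypeSpace hE M)) :
    toTypeSpace hE M ⁻¹' (translate hE M hinv g hg ⁻¹' K) = g⁻¹ • toTypeSpace hE M ⁻¹' K := by
  ext x
  rw [mem_smul_set_iff_inv_smul_mem, inv_inv]
  rfl

lemma continuous_translate {g : G.Points N} (hg : g ∈ pointsIn (M : Set N)) :
    Continuous (translate hE M hinv g hg) := by
  refine continuous_iff_isClosed.2 fun K hK => ?_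
  rw [isClosed_typeSpace_iff, preimage_toTypeSpace_translate]
  exact (isClosed_typeSpace_iff.1 hK).smul (inv_mem_pointsIn hg)

lemma translate_inv_translate {g : G.Points N} (hg : g ∈ pointsIn (M : Set N))
    (hg' : g⁻¹ ∈ pointsIn (M : Set N)) (p : E.TypeSpace hE M) :
    translate hE M hinv g⁻¹ hg' (translate hE M hinv g hg p) = p := by
  obtain ⟨x, rfl⟩ := toTypeSpace_surjective p
  exact congrArg (toTypeSpace hE M) (inv_mul_cancel_left g x)

lemma translate_translate_inv {g : G.Points N} (hg : g ∈ pointsIn (M : Set N))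
    (hg' : g⁻¹ ∈ pointsIn (M : Set N)) (p : E.TypeSpace hE M) :
    translate hE M hinv g hg (translate hE M hinv g⁻¹ hg' p) = p := by
  obtain ⟨x, rfl⟩ := toTypeSpace_surjective p
  exact congrArg (toTypeSpace hE M) (mul_inv_cancel_left g x)

variable (hE hinv) in
/-- Translation by an element of `G(M)` as a homeomorphism of `S_{G/E_M}(M)`. -/
def translateHomeomorph {g : G.Points N} (hg : g ∈ pointsIn (M : Set N)) :
    E.TypeSpace hE M ≃ₜ E.TypeSpace hE M where
  toFun := translate hE M hinv g hg
  invFun := translate hE M hinv g⁻¹ (inv_mem_pointsIn hg)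
  left_inv := translate_inv_translate hg _
  right_inv := translate_translate_inv hg _
  continuous_toFun := continuous_translate hg
  continuous_invFun := continuous_translate _

variable [Nonempty I] [IsDirectedOrder I]

theorem HasInvariantMeasure.exists_isLocalPreMean (hN : IsMonster L κ N) (hM : #M < κ)
    (h : E.HasInvariantMeasure hE M hinv) : ∃ m, E.IsLocalPreMean (M : Set N) m := by
  obtain ⟨μ, hμ, hμinv⟩ := h
  have hmeas : ∀ {Y : Set (G.Points N)}, IsDefinableOver (M : Set N) Y →
      MeasurableSet (toTypeSpace hE M '' Y) := fun hY =>
    (isClosed_image_toTypeSpace hN hM hY.isTypeDefinableOver).measurableSet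
  refine ⟨fun Y => μ.real (toTypeSpace hE M '' Y), ?_, ?_, ?_, ?_, ?_, ?_, ?_⟩
  · exact fun Y _ => ⟨measureReal_nonneg, measureReal_le_one⟩
  · simp
  · rw [image_univ, toTypeSpace_surjective.range_eq, probReal_univ]
  · exact fun Y Z _ _ hYZ => measureReal_mono (image_mono hYZ)
  · intro Y Z _ _
    rw [image_union]
    exact measureReal_union_le _ _
  · intro Y Z hY hZ i n g b hg hb hYZ
    rw [image_union]
    refine measureReal_union ?_ (hmeas hZ)
    rw [Set.disjoint_left]
    rintro _ hy ⟨x, hx, rfl⟩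
    have hx' : x ∈ toTypeSpace hE M ⁻¹' (toTypeSpace hE M '' Y) := hy
    rw [preimage_image_toTypeSpace hY.isTypeDefinableOver] at hx'
    obtain ⟨y, hy, hyx⟩ := hx'
    refine Set.eq_empty_iff_forall_notMem.1 hYZ x ⟨⟨y, hy, mem_iInter.2 fun k => ?_⟩, hx⟩
    -- Invariance under `g k ∈ G(M)` puts `E_M` inside each translated instance, so a common point
    -- of the images would contradict separation.
    exact mem_smul_rel.2 (hinv _ (inv_mem_pointsIn (hg k)) _ _ hyx i (b k) (hb k))
  · intro g hg Y hY
    have h := (hμinv g hg).measureReal_preimage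
      (hmeas (hY.smul hg)).nullMeasurableSet
    rw [preimage_translate_image] at h
    exact h.symm

/-- Modularity of `ρ` gives additivity and subadditivity on compact sets, hence a content. Its
regularity is not needed: total mass and invariance already pass to the induced measure. -/
theorem hasInvariantMeasure_of_hasInvariantMean (hN : IsMonster L κ N) (hM : #M < κ)
    (h : HasInvariantMean (E.lattice κ (M : Set N)) (pointsIn (M : Set N))) :
    E.HasInvariantMeasure hE M hinv := by
  obtain ⟨ρ, hρ, hρinv⟩ := h
  have := t2Space_typeSpace (hE := hE) hN hM
  have := compactSpace_typeSpace (hE := hE) hN hM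
  have hmem : ∀ K : Compacts (E.TypeSpace hE M),
      toTypeSpace hE M ⁻¹' K ∈ E.lattice κ (M : Set N) := fun K =>
    preimage_mem_lattice hM K.isCompact.isClosed
  have hnonneg : ∀ K : Compacts (E.TypeSpace hE M), 0 ≤ ρ (toTypeSpace hE M ⁻¹' K) := fun K =>
    (hρ.mem_Icc _ (hmem K)).1
  have hmod : ∀ K₁ K₂ : Compacts (E.TypeSpace hE M),
      ρ (toTypeSpace hE M ⁻¹' (K₁ ∪ K₂ : Set (E.TypeSpace hE M))) =
        ρ (toTypeSpace hE M ⁻¹' K₁) + ρ (toTypeSpace hE M ⁻¹' K₂) -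
          ρ (toTypeSpace hE M ⁻¹' (K₁ ∩ K₂ : Set (E.TypeSpace hE M))) := fun K₁ K₂ =>
    hρ.modular _ (hmem K₁) _ (hmem K₂)
  let c : Content (E.TypeSpace hE M) :=
    { toFun := fun K => (ρ (toTypeSpace hE M ⁻¹' K)).toNNReal
      mono' := fun K₁ K₂ h => Real.toNNReal_mono
        (hρ.monotone _ (hmem K₁) _ (hmem K₂) (preimage_mono h))
      sup_disjoint' := fun K₁ K₂ h _ _ => by
        rw [← Real.toNNReal_add (hnonneg K₁) (hnonneg K₂), Compacts.coe_sup, hmod, h.inter_eq,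
          preimage_empty, hρ.empty, sub_zero]
      sup_le' := fun K₁ K₂ => by
        rw [← Real.toNNReal_add (hnonneg K₁) (hnonneg K₂), Compacts.coe_sup, hmod]
        exact Real.toNNReal_mono (sub_le_self _ (hρ.mem_Icc _ (preimage_mem_lattice (hE := hE) hM
          (K₁.isCompact.isClosed.inter K₂.isCompact.isClosed))).1) }
  have hc : ∀ K, c K = ENNReal.ofReal (ρ (toTypeSpace hE M ⁻¹' K)) := fun _ => rfl
  refine ⟨c.measure, ⟨?_⟩, fun g hg => ⟨(continuous_translate hg).measurable, ?_⟩⟩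
  -- The whole space is both open and compact, so its measure is the content itself, namely `ρ
  -- Set.univ = 1`.
  · rw [Content.measure_apply _ MeasurableSet.univ, Content.outerMeasure_of_isOpen _ _ isOpen_univ,
      Content.innerContent_of_isCompact _ isCompact_univ isOpen_univ, hc]
    simp [hρ.univ]
  · refine Measure.ext fun s hs => ?_
    rw [Measure.map_apply (continuous_translate hg).measurable hs, Content.measure_apply _ hs,
      Content.measure_apply _ ((continuous_translate hg).measurable hs)]
    refine Content.outerMeasure_preimage c (translateHomeomorph hE hinv hg) (fun K => ?_) s
    rw [hc, hc]
    congr 1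
    rw [← hρinv g hg _ (hmem K)]
    congr 1
    ext x
    rw [mem_smul_set_iff_inv_smul_mem, mem_preimage, mem_preimage, Compacts.coe_map]
    refine ((translateHomeomorph hE hinv hg).toEquiv.image_eq_preimage_symm (K : Set _)).symm ▸ ?_
    rfl

end Measure

end VeeFamily

end

end VeeAmenability

/-! ### The equivalences and the independence of the model -/

open VeeAmenability VeeAmenability.DefinableGroup in
theorem mainTheorem11 {L : FirstOrder.Language.{u, v}} {T : L.Theory} (hT : T.IsComplete)
    (G : DefinableGroup.{u, v, w} T) {I : Type z} [Preorder I] [IsDirectedOrder I] [Nonempty I]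
    (E : VeeFamily G I) (hE : E.DefinesEquivalence) :
    -- the equivalence, for a small model `M` of a monster model `N`
    (∀ (κ : Cardinal.{w}) (N : Type w) [L.Structure N] [N ⊨ T] [Nonempty N], IsMonster L κ N →
      ∀ M : L.ElementarySubstructure N, #M < κ → ∀ hinv : E.IsInvariant (M : Set N),
        List.TFAE [
          E.HasInvariantMeasure hE M hinv,
          E.HasInvariantGPreMean (M : Set N) (pointsIn (M : Set N)),
          E.HasInvariantGPreMean (M : Set N) Set.univ,
          HasInvariantMean (E.lattice κ (M : Set N)) (pointsIn (M : Set N)),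
          HasInvariantMean (E.lattice κ (M : Set N)) Set.univ]) ∧
    -- independence of the choice of the model and of the monster model
    (∀ (κ₁ κ₂ : Cardinal.{w}) (N₁ N₂ : Type w) [L.Structure N₁] [L.Structure N₂]
      [N₁ ⊨ T] [N₂ ⊨ T] [Nonempty N₁] [Nonempty N₂], IsMonster L κ₁ N₁ → IsMonster L κ₂ N₂ →
      ∀ (M₁ : L.ElementarySubstructure N₁) (M₂ : L.ElementarySubstructure N₂),
        #M₁ < κ₁ → #M₂ < κ₂ →
        (E.HasInvariantGPreMean (M₁ : Set N₁) Set.univ ↔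
          E.HasInvariantGPreMean (M₂ : Set N₂) Set.univ) ∧
        (HasInvariantMean (E.lattice κ₁ (M₁ : Set N₁)) Set.univ ↔
          HasInvariantMean (E.lattice κ₂ (M₂ : Set N₂)) Set.univ) ∧
        (∀ (hinv₁ : E.IsInvariant (M₁ : Set N₁)) (hinv₂ : E.IsInvariant (M₂ : Set N₂)),
          E.HasInvariantMeasure hE M₁ hinv₁ ↔ E.HasInvariantMeasure hE M₂ hinv₂)) := by
  -- A weakly invariant pre-mean over one model yields a fully invariant one over every model; both
  -- 2 → 3 and part (b) are instances.
  have key : ∀ (N : Type w) [L.Structure N] [N ⊨ T] [Nonempty N] (M : L.ElementarySubstructure N)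
      (N' : Type w) [L.Structure N'] [N' ⊨ T] [Nonempty N'] (M' : Set N'),
      E.HasInvariantGPreMean (M : Set N) (pointsIn (M : Set N)) →
        E.HasInvariantGPreMean M' Set.univ := by
    rintro N _ _ _ M N' _ _ _ M' ⟨m, hm, hinv⟩
    exact (hm.isLocalPreMean hinv).hasInvariantGPreMean hT M'
  have hweak : ∀ (N : Type w) [L.Structure N] [N ⊨ T] [Nonempty N]
      (M : L.ElementarySubstructure N), E.HasInvariantGPreMean (M : Set N) Set.univ →
        E.HasInvariantGPreMean (M : Set N) (pointsIn (M : Set N)) := by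
    rintro N _ _ _ M ⟨m, hm, hinv⟩
    exact ⟨m, hm, fun g _ => hinv g (mem_univ g)⟩
  have tfae : ∀ (κ : Cardinal.{w}) (N : Type w) [L.Structure N] [N ⊨ T] [Nonempty N],
      IsMonster L κ N → ∀ M : L.ElementarySubstructure N, #M < κ →
      ∀ hinv : E.IsInvariant (M : Set N), List.TFAE [
          E.HasInvariantMeasure hE M hinv,
          E.HasInvariantGPreMean (M : Set N) (pointsIn (M : Set N)),
          E.HasInvariantGPreMean (M : Set N) Set.univ,
          HasInvariantMean (E.lattice κ (M : Set N)) (pointsIn (M : Set N)),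
          HasInvariantMean (E.lattice κ (M : Set N)) Set.univ] := by
    intro κ N _ _ _ hN M hM hinv
    tfae_have 1 → 3 := fun h =>
      let ⟨_, hm⟩ := h.exists_isLocalPreMean hN hM
      hm.hasInvariantGPreMean hT _
    tfae_have 3 → 2 := hweak N M
    tfae_have 2 → 3 := key N M N M
    tfae_have 3 → 5 := fun h => h.hasInvariantMean hE hN hM
    tfae_have 5 → 4 := fun ⟨ρ, hρ, h⟩ => ⟨ρ, hρ, fun g _ => h g (mem_univ g)⟩
    tfae_have 4 → 1 := fun h => VeeFamily.hasInvariantMeasure_of_hasInvariantMean hN hM h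
    tfae_finish
  refine ⟨tfae, fun κ₁ κ₂ N₁ N₂ _ _ _ _ _ _ hN₁ hN₂ M₁ M₂ hM₁ hM₂ => ?_⟩
  have hpre : E.HasInvariantGPreMean (M₁ : Set N₁) Set.univ ↔
      E.HasInvariantGPreMean (M₂ : Set N₂) Set.univ :=
    ⟨fun h => key N₁ M₁ N₂ M₂ (hweak N₁ M₁ h), fun h => key N₂ M₂ N₁ M₁ (hweak N₂ M₂ h)⟩
  refine ⟨hpre, ?_, fun hinv₁ hinv₂ => ?_⟩
  -- Means are not transferred directly: they pass through pre-means, which requires no invariance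
  -- of `E_M`.
  · exact ⟨fun h => (hpre.1 (h.hasInvariantGPreMean hE hN₁ hM₁)).hasInvariantMean hE hN₂ hM₂,
      fun h => (hpre.2 (h.hasInvariantGPreMean hE hN₂ hM₂)).hasInvariantMean hE hN₁ hM₁⟩
  · exact (((tfae κ₁ N₁ hN₁ M₁ hM₁ hinv₁).out 0 2).trans hpre).trans
      ((tfae κ₂ N₂ hN₂ M₂ hM₂ hinv₂).out 2 0)
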